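/- Let $K$ be a field, $S=K[x_1,\dots,x_n]$ with the standard grading, and let $t\ge 0$ be an integer with $t\le n-2$. Let $(K_\bullet,\partial_\bullet)$ be the Koszul complex of $x_1,\dots,x_n$: $K_j$ is the graded free $S$-module on the elements $e_J$ of degree $j$, $J\subset[n]=\{1,\dots,n\}$, $|J|=j$, with dual basis $e_J^*$. For $j\ge 1$ let $E_j=\operatorname{Im}(\partial_j)\subset K_{j-1}$ be the $j$-th syzygy module of the residue field. For disjoint $J,T\subset[n]$ put $\sigma(J,T)=(-1)^{\#\{(j,k)\in J\times T\,:\,j>k\}}$, and let $\mathcal A\subset\operatorname{Hom}_S(K_{t+1},S(-n))$ be the $S$-submodule $$\mathcal A=\Big\langle \sum_{j=1}^{n-t}(-1)^{j+1}\sigma\big(L\setminus\{i_j\},([n]\setminus L)\cup\{i_j\}\big)\,x_{i_j}\,e^*_{([n]\setminus L)\cup\{i_j\}}\ :\ L=\{i_1<\dots<i_{n-t}\}\subset[n]\Big\rangle .$$ Let $c\in\mathbb Z$ and let $I\subset S$ be an ideal. In (i) and (i') below, $I$ is moreover required to be nonzero in the case $t=n-2$. 1. Let $p,q\ge 0$ and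 $a_1,\dots,a_p,b_1,\dots,b_q\in\mathbb Z$. The following are equivalent. (i) $I$ is a graded ideal and there is an exact sequence of graded $S$-modules, with maps of degree $0$, $$0\to\bigoplus_{i=1}^pS(-a_i)\to\bigoplus_{i=1}^qS(-b_i)\to E_{t+1}\to I(c)\to 0$$ in which none of the $q$ standard basis elements of $\bigoplus_i S(-b_i)$ is mapped to $0$ in $E_{t+1}$. (ii) There are homogeneous elements $\beta_1,\dots,\beta_q\in K_{t+1}\setminus E_{t+2}$ with $\deg\beta_i=b_i$ and $\varphi\in\mathcal A$ such that $I=\varphi(K_{t+1})$ as an ideal of $S$ (up to the shift of the grading) and (a) $\varphi:K_{t+1}\to S(-n)$ is homogeneous of degree $n+c$ and $\operatorname{Ker}\varphi=\langle\beta_1,\dots,\beta_q\rangle+E_{t+2}$; (b) $p=q+1-\binom{n-1}{t}$, and, for the map $\beta:\bigoplus_{i=1}^qS(-b_i)\to K_{t+1}$ sending the $i$-th basis element to $\beta_i$, there is an injective homomorphism $\iota:\bigoplus_{i=1}^pS(-a_i)\to\bigoplus_{i=1}^qS(-b_i)$ of degree $0$ such that, with $\operatorname{Res}(\beta)=\beta\circ\iota$,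 the diagram $$\begin{array}{ccccccc} & & 0 & & 0 & & \\ & & \downarrow & & \downarrow & & \\ 0&\to&\operatorname{Ker}\operatorname{Res}(\beta)&\to&\operatorname{Ker}\beta&\to&0\\ & & \downarrow & & \downarrow & & \\ 0&\to&\bigoplus_{i=1}^pS(-a_i)&\xrightarrow{\ \iota\ }&\bigoplus_{i=1}^qS(-b_i)& & \\ & & {\scriptstyle\operatorname{Res}(\beta)}\downarrow & & {\scriptstyle\beta}\downarrow & & \\ 0&\to&\langle\beta_1,\dots,\beta_q\rangle\cap E_{t+2}&\to&\langle\beta_1,\dots,\beta_q\rangle& & \\ & & \downarrow & & \downarrow & & \\ & & 0 & & 0 & & \end{array}$$ is commutative with exact rows and columns, its first row being induced by $\iota$. 2. The following are also equivalent: (i') $I$ is a graded ideal and there is an exact sequence as in (i) for some $p,q,a_i,b_i$, where basis elements of $\bigoplus_i S(-b_i)$ may be mapped to $0$; (ii') for some $p,q,a_i,b_i$ there are $\beta_1,\dots,\beta_q$ and $\varphi$ as in (ii), with $I=\varphi(K_{t+1})$. -/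

import Mathlib

open MvPolynomial

noncomputable section

namespace LongBourbaki

/-- The polynomial ring `S = K[x_1, …, x_n]`. -/
abbrev Poly (K : Type*) [Field K] (n : ℕ) : Type _ := MvPolynomial (Fin n) K

section Grading

variable {K : Type*} [Field K] {n : ℕ}

/-- The homogeneous component `S_d` of the standard grading, for every integer `d`
(it is zero when `d` is negative). -/
def polyDeg (d : ℤ) : Submodule K (Poly K n) where
  carrier := {f | ∀ m : Fin n →₀ ℕ, coeff m f ≠ 0 → (m.degree : ℤ) = d}
  zero_mem' := by
    intro m hm
    simp at hm
  add_mem' := by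
    intro f g hf hg m hm
    by_cases h : coeff m f = 0
    · exact hg m (fun h' => hm (by simp [h, h']))
    · exact hf m h
  smul_mem' := by
    intro r f hf m hm
    exact hf m (fun h => hm (by simp [h]))

/-- The twist `M(c)` of a grading: `M(c)_d = M_{c + d}`. -/
def twist {M : Type*} [AddCommGroup M] [Module K M] (gr : ℤ → Submodule K M) (c : ℤ) :
    ℤ → Submodule K M :=
  fun d => gr (c + d)

/-- The grading of the free module `⊕ i, S(-a i)`. -/
def freeDeg {ι : Type*} (a : ι → ℤ) (d : ℤ) : Submodule K (ι → Poly K n) where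
  carrier := {v | ∀ i, v i ∈ twist (polyDeg (K := K) (n := n)) (-(a i)) d}
  zero_mem' := fun _ => zero_mem _
  add_mem' := fun hv hw i => add_mem (hv i) (hw i)
  smul_mem' := fun r _ hv i => Submodule.smul_mem _ r (hv i)

/-- The grading which a submodule `N` of a graded module inherits: `N_d = N ∩ M_d`. -/
def subDeg {M : Type*} [AddCommGroup M] [Module K M] [Module (Poly K n) M]
    [IsScalarTower K (Poly K n) M] (gr : ℤ → Submodule K M) (N : Submodule (Poly K n) M) :
    ℤ → Submodule K N :=
  fun d => (gr d).comap (N.subtype.restrictScalars K)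

/-- `f` is a homomorphism of degree `e` between graded modules. -/
def IsOfDegree {M M' : Type*} [AddCommGroup M] [Module K M] [Module (Poly K n) M]
    [AddCommGroup M'] [Module K M'] [Module (Poly K n) M']
    (gr : ℤ → Submodule K M) (gr' : ℤ → Submodule K M') (e : ℤ)
    (f : M →ₗ[Poly K n] M') : Prop :=
  ∀ d : ℤ, ∀ x ∈ gr d, f x ∈ gr' (e + d)

attribute [local instance] MvPolynomial.gradedAlgebra in
/-- Graded ideals of `S`. -/
def IsGradedIdeal (I : Ideal (Poly K n)) : Prop :=
  I.IsHomogeneous (homogeneousSubmodule (Fin n) K)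

end Grading

section Koszul

variable (K : Type*) [Field K] (n : ℕ)

/-- The module `K_j` of the Koszul complex of `x_1, …, x_n`: it is free on the `e_J`,
where `J` runs through the subsets of `[n]` with `j` elements. -/
abbrev Koszul (j : ℕ) : Type _ := {J : Finset (Fin n) // J.card = j} → Poly K n

/-- The grading of `K_j`, in which each `e_J` has degree `j`. -/
def koszulDeg (j : ℕ) : ℤ → Submodule K (Koszul K n j) := freeDeg (fun _ => (j : ℤ))

/-- The differential `∂_{j+1} : K_{j+1} → K_j`,
`∂ e_J = ∑_{i ∈ J} (-1)^{#{k ∈ J | k < i}} x_i e_{J \ {i}}`. -/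
def koszulD (j : ℕ) : Koszul K n (j + 1) →ₗ[Poly K n] Koszul K n j :=
  Fintype.linearCombination (Poly K n) (fun J : {J : Finset (Fin n) // J.card = j + 1} =>
    ∑ i : {i // i ∈ J.1},
      Pi.single (M := fun _ : {T : Finset (Fin n) // T.card = j} => Poly K n)
        ⟨J.1.erase i.1, by rw [Finset.card_erase_of_mem i.2, J.2]; rfl⟩
        ((-1) ^ (J.1.filter (fun k => k < i.1)).card * X i.1))

/-- `syz K n j` is the syzygy module `E_{j+1} = Im ∂_{j+1} ⊆ K_j` of the residue field. -/
def syz (j : ℕ) : Submodule (Poly K n) (Koszul K n j) := LinearMap.range (koszulD K n j)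

/-- The sign `σ(J, T) = (-1)^{#{(j, k) ∈ J × T | j > k}}`. -/
def sgn (J T : Finset (Fin n)) : Poly K n :=
  (-1) ^ ((J ×ˢ T).filter (fun r => r.2 < r.1)).card

theorem card_insert_compl {n t : ℕ} {L : Finset (Fin n)} (hL : L.card = n - t) {i : Fin n}
    (hi : i ∈ L) : (insert i Lᶜ).card = t + 1 := by
  have h1 : i ∉ Lᶜ := by simpa using hi
  have h2 : 0 < L.card := Finset.card_pos.mpr ⟨i, hi⟩
  have h3 := Finset.card_compl L
  rw [Fintype.card_fin] at h3
  rw [Finset.card_insert_of_notMem h1]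
  omega

/-- For `L = {i_1 < … < i_{n-t}}`, the linear form
`∑_j (-1)^{j+1} σ(L \ {i_j}, ([n] \ L) ∪ {i_j}) x_{i_j} e^*_{([n] \ L) ∪ {i_j}}` on `K_{t+1}`.
The index `j` below starts at `0`. -/
def genA (t : ℕ) (L : Finset (Fin n)) (hL : L.card = n - t) :
    Koszul K n (t + 1) →ₗ[Poly K n] Poly K n :=
  ∑ j : Fin (n - t),
    ((-1) ^ (((j : ℕ) + 1) + 1) *
      sgn K n (L.erase (L.orderEmbOfFin hL j)) (insert (L.orderEmbOfFin hL j) Lᶜ) *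
      X (L.orderEmbOfFin hL j)) •
    LinearMap.proj (R := Poly K n)
      (φ := fun _ : {J : Finset (Fin n) // J.card = t + 1} => Poly K n)
      ⟨insert (L.orderEmbOfFin hL j) Lᶜ,
        card_insert_compl hL (L.orderEmbOfFin_mem hL j)⟩

/-- The submodule `𝒜` of `Hom(K_{t+1}, S)` generated by these linear forms. -/
def calA (t : ℕ) : Submodule (Poly K n) (Koszul K n (t + 1) →ₗ[Poly K n] Poly K n) :=
  Submodule.span (Poly K n)
    {θ | ∃ (L : Finset (Fin n)) (hL : L.card = n - t), θ = genA K n t L hL}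

end Koszul

section Sequences

variable {K : Type*} [Field K] {n : ℕ}

/-- The maps `f`, `g`, `h` form a long Bourbaki sequence
`0 → ⊕ S(-a i) → ⊕ S(-b i) → E_{t+1} → I(c) → 0`: they are homogeneous of degree zero and
the sequence is exact. -/
structure IsBourbakiSeq (t : ℕ) {p q : ℕ} (a : Fin p → ℤ) (b : Fin q → ℤ) (c : ℤ)
    (I : Ideal (Poly K n))
    (f : (Fin p → Poly K n) →ₗ[Poly K n] (Fin q → Poly K n))
    (g : (Fin q → Poly K n) →ₗ[Poly K n] syz K n t)
    (h : syz K n t →ₗ[Poly K n] I) : Prop where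
  degree_f : IsOfDegree (freeDeg (K := K) a) (freeDeg (K := K) b) 0 f
  degree_g : IsOfDegree (freeDeg (K := K) b) (subDeg (koszulDeg K n t) (syz K n t)) 0 g
  degree_h : IsOfDegree (subDeg (koszulDeg K n t) (syz K n t))
    (twist (subDeg (polyDeg (K := K) (n := n)) I) c) 0 h
  injective : Function.Injective f
  exact_fg : Function.Exact f g
  exact_gh : Function.Exact g h
  surjective : Function.Surjective h

/-- The conditions on `β_1, …, β_q ∈ K_{t+1} ∖ E_{t+2}` and `φ ∈ 𝒜`. The map
`β : ⊕ S(-b i) → K_{t+1}` that sends the `i`-th basis element to `β_i` is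
`Fintype.linearCombination _ β`; it is homogeneous, i.e. `β_i` has degree `b i`. -/
structure IsBourbakiDatum (t : ℕ) {p q : ℕ} (a : Fin p → ℤ) (b : Fin q → ℤ) (c : ℤ)
    (β : Fin q → Koszul K n (t + 1))
    (φ : Koszul K n (t + 1) →ₗ[Poly K n] Poly K n) : Prop where
  degree_β : ∀ i, β i ∈ koszulDeg K n (t + 1) (b i)
  notMem : ∀ i, β i ∉ syz K n (t + 1)
  mem_calA : φ ∈ calA K n t
  /-- `φ` is homogeneous of degree `n + c` as a map to `S(-n)`. -/
  degree_φ : IsOfDegree (koszulDeg K n (t + 1))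
    (twist (polyDeg (K := K) (n := n)) (-(n : ℤ))) ((n : ℤ) + c) φ
  ker_φ : LinearMap.ker φ = Submodule.span (Poly K n) (Set.range β) ⊔ syz K n (t + 1)
  rank_eq : (p : ℤ) = (q : ℤ) + 1 - ((n - 1).choose t : ℤ)
  /-- The commutative diagram with exact rows and columns: `ι` is the embedding in the middle
  row, `Res(β) = β ∘ ι` maps onto `⟨β_1, …, β_q⟩ ∩ E_{t+2}`, and `ι` induces an isomorphism of
  `Ker Res(β)` onto `Ker β`. -/
  diagram : ∃ ι : (Fin p → Poly K n) →ₗ[Poly K n] (Fin q → Poly K n),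
    IsOfDegree (freeDeg (K := K) a) (freeDeg (K := K) b) 0 ι ∧
    Function.Injective ι ∧
    LinearMap.range (Fintype.linearCombination (Poly K n) β ∘ₗ ι) =
      Submodule.span (Poly K n) (Set.range β) ⊓ syz K n (t + 1) ∧
    (LinearMap.ker (Fintype.linearCombination (Poly K n) β ∘ₗ ι)).map ι =
      LinearMap.ker (Fintype.linearCombination (Poly K n) β)

end Sequences

end LongBourbaki

end

/-! Everything rests on two exactness statements. The Koszul complex is exact at `K_{t+1}`, so `Ker
∂_{t+1} = E_{t+2}` (`ker_koszulD`). Its dual is exact at `K_{t+1}^*` because `t + 1 < n`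
(`exists_comp_koszulD`). The generators of `𝒜` are, up to sign, the coordinates of `∂_{t+1}`; hence
`φ ∈ 𝒜` means that `φ` factors through `∂_{t+1}`, which by exactness of the dual means that `φ`
vanishes on `E_{t+2}` (`mem_calA_iff`). So the `φ` in `𝒜` are exactly the maps induced by linear
forms on `E_{t+1}`.

The two kinds of data then translate into each other. From a sequence, `β_i` is a homogeneous lift
of the image of the `i`-th basis element, `φ` is the composite of `∂_{t+1}` with `E_{t+1} → I(c)`,
and `ι` is the injection of free modules (`IsBourbakiSeq.exists_datum`). Conversely, `∂_{t+1} ∘ β`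
and the map induced by `φ` give the sequence (`IsBourbakiDatum.exists_seq`). The diagram says
precisely that `ι` maps onto the kernel of `∂_{t+1} ∘ β`.

The formula for `p` is additivity of rank together with `rank I = 1`, so it amounts to `I ≠ 0`. For
`t < n - 2` this is automatic, since `E_{t+1}` has no free resolution of length one
(`not_exact_of_lt`).

For arbitrary sequences, a basis element that goes to zero lies in the image of the injection. By
homogeneity its preimage has a unit coordinate, so one basis element can be cancelled on each side
(`IsBourbakiSeq.cancel`). -/

noncomputable section

namespace LongBourbaki

/-! ### Acyclicity of a Koszul-type complex with arbitrary anticommuting signs. -/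

section SignedBoundary

variable {K : Type*} [Field K] {n : ℕ}

/-- The Koszul differential with signs `ε`, on families indexed by all subsets of `[n]`. -/
def signedBoundary (ε : Fin n → Finset (Fin n) → K) (z : Finset (Fin n) → Poly K n)
    (J : Finset (Fin n)) : Poly K n :=
  ∑ k ∈ Jᶜ, C (ε k J) * X k * z (insert k J)

theorem coeff_signedBoundary (ε : Fin n → Finset (Fin n) → K) (z : Finset (Fin n) → Poly K n)
    (J : Finset (Fin n)) (m : Fin n →₀ ℕ) :
    coeff m (signedBoundary ε z J) =
      ∑ k ∈ Jᶜ, if m k ≠ 0 then ε k J * coeff (m - Finsupp.single k 1) (z (insert k J)) else 0 := by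
  simp only [signedBoundary, coeff_sum, mul_assoc, coeff_C_mul, coeff_X_mul', Finsupp.mem_support_iff,
    mul_ite, mul_zero]

/-- The signs `ε` are units and anticommute, so that they define a complex. -/
structure AntiSigns (ε : Fin n → Finset (Fin n) → K) : Prop where
  mul_self : ∀ k J, ε k J * ε k J = 1
  anti : ∀ k l J, k ≠ l → k ∉ J → l ∉ J →
    ε k (insert l J) * ε l J = -(ε l (insert k J) * ε k J)

theorem signedBoundary_signedBoundary {ε : Fin n → Finset (Fin n) → K} (hε : AntiSigns ε)
    (z : Finset (Fin n) → Poly K n) (J : Finset (Fin n)) :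
    signedBoundary ε (signedBoundary ε z) J = 0 := by
  simp only [signedBoundary, Finset.mul_sum]
  rw [Finset.sum_sigma']
  refine Finset.sum_involution (fun x _ => ⟨x.2, x.1⟩) ?_ ?_ ?_ ?_
  · rintro ⟨k, l⟩ h
    simp only [Finset.mem_sigma, Finset.mem_compl, Finset.mem_insert, not_or] at h
    obtain ⟨hk, hlk, hl⟩ := h
    have h := congrArg (C (σ := Fin n)) (hε.anti k l J (Ne.symm hlk) hk hl)
    simp only [map_mul, map_neg] at h
    rw [Finset.insert_comm l k J]
    linear_combination (X k * X l * z (insert k (insert l J))) * h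
  · rintro ⟨k, l⟩ h - h'
    simp only [Finset.mem_sigma, Finset.mem_compl, Finset.mem_insert, not_or] at h
    simp only [Sigma.mk.injEq] at h'
    exact h.2.1 h'.1
  · rintro ⟨k, l⟩ h
    simp only [Finset.mem_sigma, Finset.mem_compl, Finset.mem_insert, not_or] at h ⊢
    exact ⟨h.2.2, Ne.symm h.2.1, h.1⟩
  · rintro ⟨k, l⟩ h
    rfl

theorem exists_coeff_eq_ite (P : (Fin n →₀ ℕ) → Prop) [DecidablePred P] (s : Fin n →₀ ℕ)
    (f : Poly K n) :
    ∃ g : Poly K n, ∀ m, coeff m g = if P m then coeff (m + s) f else 0 := by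
  refine ⟨∑ m ∈ (divMonomial f s).support with P m, monomial m (coeff (m + s) f), fun m => ?_⟩
  have hm : m ∈ (divMonomial f s).support.filter P ↔ coeff (m + s) f ≠ 0 ∧ P m := by
    rw [Finset.mem_filter, mem_support_iff, coeff_divMonomial, add_comm]
  simp only [coeff_sum, coeff_monomial]
  rw [Finset.sum_ite_eq']
  by_cases hP : P m
  · by_cases h : coeff (m + s) f = 0
    · rw [if_neg (fun h' => (hm.1 h').1 h), if_pos hP, h]
    · rw [if_pos (hm.2 ⟨h, hP⟩), if_pos hP]
  · rw [if_neg (fun h' => hP (hm.1 h').2), if_neg hP]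

/-- A contracting homotopy in each multidegree: if `i` is the least index occurring in `x^m e_T` and
`i ∉ T`, then `x_i` is divided out and `i` is added to `T`. Nothing but signs is divided by, so the
characteristic is irrelevant. -/
theorem exists_contraction {ε : Fin n → Finset (Fin n) → K} (z : Finset (Fin n) → Poly K n) :
    ∃ w : Finset (Fin n) → Poly K n, ∀ (i : Fin n) (T : Finset (Fin n)), i ∉ T → (∀ l ∈ T, i ≤ l) →
      ∀ m, coeff m (w (insert i T)) =
        if ∀ k < i, m k = 0 then ε i T * coeff (m + Finsupp.single i 1) (z T) else 0 := by
  classical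
  choose D hD using fun (i : Fin n) (f : Poly K n) =>
    exists_coeff_eq_ite (fun m => ∀ k < i, m k = 0) (Finsupp.single i 1) f
  refine ⟨fun T => if h : T.Nonempty then
    C (ε (T.min' h) (T.erase (T.min' h))) * D (T.min' h) (z (T.erase (T.min' h))) else 0, ?_⟩
  intro i T hi hT m
  have hne : (insert i T).Nonempty := Finset.insert_nonempty i T
  have hmin : (insert i T).min' hne = i := by
    apply le_antisymm
    · exact Finset.min'_le _ _ (Finset.mem_insert_self i T)
    · refine Finset.le_min' _ _ _ fun l hl => ?_
      rcases Finset.mem_insert.1 hl with rfl | hl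
      · exact le_rfl
      · exact hT l hl
  simp only [hne, dite_true, hmin, Finset.erase_insert hi, coeff_C_mul, hD]
  split_ifs <;> simp

/-- The contraction of `z` is a primitive, checked monomial by monomial on the least index `i` of `J
∪ supp m`. The only position without such an index is `J = ∅`, `m = 0`, and `h0` covers it. -/
theorem exists_signedBoundary_eq {ε : Fin n → Finset (Fin n) → K} (hε : AntiSigns ε)
    (z : Finset (Fin n) → Poly K n) (hz : ∀ J, signedBoundary ε z J = 0) (h0 : z ∅ = 0) :
    ∃ w : Finset (Fin n) → Poly K n, ∀ J, signedBoundary ε w J = z J := by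
  classical
  obtain ⟨w, hw⟩ := exists_contraction (ε := ε) z
  refine ⟨w, fun J => MvPolynomial.ext _ _ fun m => ?_⟩
  rw [coeff_signedBoundary]
  rcases (J ∪ m.support).eq_empty_or_nonempty with hJm | hJm
  · obtain ⟨rfl, hm⟩ := Finset.union_eq_empty.1 hJm
    have hm0 : m = 0 := Finsupp.support_eq_empty.1 hm
    subst hm0
    simp [h0]
  obtain ⟨i, hi, hmin⟩ : ∃ i ∈ J ∪ m.support, ∀ l ∈ J ∪ m.support, i ≤ l :=
    ⟨_, Finset.min'_mem _ hJm, fun l hl => Finset.min'_le _ l hl⟩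
  have hminJ : ∀ l ∈ J, i ≤ l := fun l hl => hmin l (Finset.mem_union_left _ hl)
  have hminm : ∀ l, m l ≠ 0 → i ≤ l := fun l hl =>
    hmin l (Finset.mem_union_right _ (Finsupp.mem_support_iff.2 hl))
  by_cases hiJ : i ∈ J
  · obtain ⟨T, hiT, rfl⟩ : ∃ T, i ∉ T ∧ J = insert i T :=
      ⟨J.erase i, Finset.notMem_erase i J, (Finset.insert_erase hiJ).symm⟩
    -- The cycle condition at `T = J \ {i}` and the monomial `x_i x^m`: its term `k = i` is the
    -- wanted coefficient of `z J`, and the others are, up to sign, the terms of the boundary of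
    -- `w`.
    have hc := congrArg (coeff (m + Finsupp.single i 1)) (hz T)
    have hsplit : Tᶜ = insert i (insert i T)ᶜ := by
      ext x
      by_cases hx : x = i <;> simp [hx, hiT]
    rw [coeff_signedBoundary, hsplit, Finset.sum_insert (by simp)] at hc
    have h1 : (m + Finsupp.single i 1 : Fin n →₀ ℕ) i ≠ 0 := by simp
    rw [if_pos h1, add_tsub_cancel_right, coeff_zero] at hc
    have key : ∀ k ∈ (insert i T)ᶜ,
        (if m k ≠ 0 then ε k (insert i T) * coeff (m - Finsupp.single k 1)
          (w (insert k (insert i T))) else 0) =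
        -ε i T * (if (m + Finsupp.single i 1 : Fin n →₀ ℕ) k ≠ 0 then ε k T *
          coeff (m + Finsupp.single i 1 - Finsupp.single k 1) (z (insert k T)) else 0) := by
      intro k hk
      simp only [Finset.mem_compl, Finset.mem_insert, not_or] at hk
      obtain ⟨hki, hkT⟩ := hk
      have hmk : (m + Finsupp.single i 1 : Fin n →₀ ℕ) k = m k := by
        simp [Ne.symm hki]
      rw [hmk]
      by_cases hk0 : m k = 0
      · simp [hk0]
      rw [if_pos hk0, if_pos hk0, Finset.insert_comm, hw i (insert k T), if_pos]
      · have hle : Finsupp.single k 1 ≤ m := by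
          rw [Finsupp.single_le_iff]; omega
        rw [tsub_add_eq_add_tsub hle]
        have ha := hε.anti k i T hki hkT hiT
        have h2 := hε.mul_self i T
        have h3 := hε.mul_self i (insert k T)
        have : ε k (insert i T) * ε i (insert k T) = -ε i T * ε k T := by
          linear_combination (ε i T * ε i (insert k T)) * ha -
            (ε k (insert i T) * ε i (insert k T)) * h2 - (ε i T * ε k T) * h3
        rw [← mul_assoc, this, mul_assoc]
      · intro l hl
        have : m l = 0 := by
          by_contra h
          exact absurd (hminm l h) (not_le.2 hl)
        simp [this]
      · simp [hiT, Ne.symm hki]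
      · intro l hl
        rcases Finset.mem_insert.1 hl with rfl | hl
        · exact hminm _ hk0
        · exact hminJ l (Finset.mem_insert_of_mem hl)
    rw [Finset.sum_congr rfl key, ← Finset.mul_sum]
    linear_combination (-ε i T) * hc + coeff m (z (insert i T)) * hε.mul_self i T
  · have him : m i ≠ 0 := by
      simpa [hiJ] using hi
    -- For `k ≠ i` the least element of `J ∪ {k}` exceeds `i`, whereas `x_i` still divides `x^m /
    -- x_k`; the truncation in `w` kills such terms.
    rw [Finset.sum_eq_single i]
    · rw [if_pos him, hw i J hiJ hminJ, if_pos, tsub_add_cancel_of_le, ← mul_assoc, hε.mul_self,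
        one_mul]
      · rw [Finsupp.single_le_iff]; omega
      · intro l hl
        have : m l = 0 := by
          by_contra h
          exact absurd (hminm l h) (not_le.2 hl)
        simp [this]
    · intro k hk hki
      rw [Finset.mem_compl] at hk
      split_ifs with hmk
      · obtain ⟨j, U, hjU, hU, hUk⟩ : ∃ j U, j ∉ U ∧ (∀ l ∈ U, j ≤ l) ∧ insert k J = insert j U := by
          have hne := Finset.insert_nonempty k J
          refine ⟨(insert k J).min' hne, (insert k J).erase _, Finset.notMem_erase _ _, ?_,
            (Finset.insert_erase (Finset.min'_mem _ _)).symm⟩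
          intro l hl
          exact Finset.min'_le _ _ (Finset.mem_of_mem_erase hl)
        have hij : i < j := by
          have hj : j ∈ insert k J := hUk ▸ Finset.mem_insert_self j U
          rcases Finset.mem_insert.1 hj with rfl | hj
          · exact lt_of_le_of_ne (hminm _ hmk) (Ne.symm hki)
          · exact lt_of_le_of_ne (hminJ _ hj) (fun h => hiJ (h ▸ hj))
        rw [hUk, hw j U hjU hU, if_neg, mul_zero]
        intro h
        have := h i hij
        simp [hki] at this
        exact him this
      · rfl
    · intro h
      exact absurd (Finset.mem_compl.2 hiJ) h

end SignedBoundary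

/-! ### Exactness of the Koszul complex and of its dual. -/

section KoszulExact

variable {K : Type*} [Field K] {n : ℕ}

/-- Extension of an element of `K_j` by zero to a family indexed by all subsets of `[n]`. -/
def extendZero {j : ℕ} (z : Koszul K n j) (J : Finset (Fin n)) : Poly K n :=
  if h : J.card = j then z ⟨J, h⟩ else 0

theorem extendZero_coe {j : ℕ} (z : Koszul K n j) (J : {J : Finset (Fin n) // J.card = j}) :
    extendZero z J.1 = z J := by
  simp [extendZero, J.2]

theorem extendZero_of_ne {j : ℕ} (z : Koszul K n j) {J : Finset (Fin n)} (h : J.card ≠ j) :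
    extendZero z J = 0 := by
  simp [extendZero, h]

/-- The signs of the Koszul complex. -/
def koszulSign (K : Type*) [Field K] {n : ℕ} (k : Fin n) (J : Finset (Fin n)) : K :=
  (-1) ^ (J.filter (fun l => l < k)).card

theorem koszulSign_mul_self (k : Fin n) (J : Finset (Fin n)) :
    koszulSign K k J * koszulSign K k J = 1 := by
  rw [koszulSign, ← mul_pow]; simp

theorem koszulSign_insert {k l : Fin n} {J : Finset (Fin n)} (hl : l ∉ J) :
    koszulSign K k (insert l J) = (if l < k then -1 else 1) * koszulSign K k J := by
  rw [koszulSign, koszulSign, Finset.filter_insert]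
  split_ifs with h
  · rw [Finset.card_insert_of_notMem (by simp [hl]), pow_succ, mul_comm]
  · rw [one_mul]

theorem koszulSign_anti {k l : Fin n} {J : Finset (Fin n)} (hkl : k ≠ l) (hk : k ∉ J)
    (hl : l ∉ J) : koszulSign K k (insert l J) * koszulSign K l J =
      -(koszulSign K l (insert k J) * koszulSign K k J) := by
  rw [koszulSign_insert hl, koszulSign_insert hk]
  rcases lt_or_gt_of_ne hkl with h | h
  · rw [if_neg (not_lt.2 h.le), if_pos h]; ring
  · rw [if_pos h, if_neg (not_lt.2 h.le)]; ring

theorem antiSigns_koszulSign : AntiSigns (koszulSign K (n := n)) :=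
  ⟨koszulSign_mul_self, fun _ _ _ => koszulSign_anti⟩

/-- Replacing index sets by their complements turns removal of `k` into insertion of `k`. With these
signs the transposed Koszul differential becomes a signed boundary, so one acyclicity lemma serves
both complexes. -/
theorem antiSigns_compl :
    AntiSigns (fun (k : Fin n) (J : Finset (Fin n)) => koszulSign K k (Jᶜ.erase k)) := by
  refine ⟨fun k J => koszulSign_mul_self _ _, fun k l J hkl hk hl => ?_⟩
  set U := (Jᶜ.erase k).erase l with hU
  have h1 : (insert l J)ᶜ.erase k = U := by
    ext x; simp [hU]; tauto
  have h2 : (insert k J)ᶜ.erase l = U := by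
    ext x; simp [hU]
  have h3 : Jᶜ.erase l = insert k U := by
    ext x; by_cases hx : x = k <;> simp [hU, hx, hk, hkl]
  have h4 : Jᶜ.erase k = insert l U := by
    ext x; by_cases hx : x = l <;> simp [hU, hx, hl, hkl.symm]
  have hkU : k ∉ U := by simp [hU]
  have hlU : l ∉ U := by simp [hU]
  simp only [h1, h2, h3, h4]
  have := koszulSign_anti (K := K) hkl hkU hlU
  linear_combination this

theorem map_koszulSign (k : Fin n) (J : Finset (Fin n)) :
    (C (koszulSign K k J) : Poly K n) = (-1) ^ (J.filter (fun l => l < k)).card := by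
  simp [koszulSign]

/-- Passes from columns to rows: only the basis elements `e_{J ∪ {k}}` with `k ∉ J` contribute to
the coordinate `J`. -/
theorem koszulD_apply {j : ℕ} (z : Koszul K n (j + 1)) (J : {J : Finset (Fin n) // J.card = j}) :
    koszulD K n j z J = signedBoundary (koszulSign K) (extendZero z) J.1 := by
  obtain ⟨J, hJ⟩ := J
  have h1 : ∀ T : {J : Finset (Fin n) // J.card = j + 1},
      (∑ i : {i // i ∈ T.1}, Pi.single (M := fun _ : {T : Finset (Fin n) // T.card = j} => Poly K n)
        ⟨T.1.erase i.1, by rw [Finset.card_erase_of_mem i.2, T.2]; rfl⟩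
        ((-1) ^ (T.1.filter (fun k => k < i.1)).card * X i.1)) ⟨J, hJ⟩ =
      ∑ i, if i ∈ T.1 ∧ J = T.1.erase i then
        ((-1) ^ (T.1.filter (fun k => k < i)).card * X i : Poly K n) else 0 := by
    intro T
    rw [Finset.sum_apply]
    simp only [Pi.single_apply, Subtype.mk.injEq]
    rw [Finset.sum_coe_sort T.1 (fun i => if J = T.1.erase i then
        ((-1) ^ (T.1.filter (fun k => k < i)).card * X i : Poly K n) else 0)]
    simp only [ite_and]
    rw [Finset.sum_ite_mem, Finset.univ_inter]
  rw [koszulD, Fintype.linearCombination_apply, Finset.sum_apply]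
  simp only [Pi.smul_apply, h1, smul_eq_mul, Finset.mul_sum]
  rw [Finset.sum_comm, signedBoundary, ← Finset.sum_subset (Finset.subset_univ Jᶜ)]
  · refine Finset.sum_congr rfl fun k hk => ?_
    rw [Finset.mem_compl] at hk
    have hc : (insert k J).card = j + 1 := by rw [Finset.card_insert_of_notMem hk, hJ]
    rw [Finset.sum_eq_single ⟨insert k J, hc⟩]
    · rw [if_pos ⟨Finset.mem_insert_self _ _, (Finset.erase_insert hk).symm⟩,
        ← extendZero_coe z ⟨insert k J, hc⟩, map_koszulSign, Finset.filter_insert,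
        if_neg (lt_irrefl k)]
      ring
    · intro T _ hT
      rw [if_neg, mul_zero]
      rintro ⟨hkT, rfl⟩
      exact hT (Subtype.ext (Finset.insert_erase hkT).symm)
    · intro h
      exact absurd (Finset.mem_univ _) h
  · intro k _ hk
    rw [Finset.mem_compl, not_not] at hk
    refine Finset.sum_eq_zero fun T _ => ?_
    rw [if_neg, mul_zero]
    rintro ⟨hkT, rfl⟩
    simp at hk

theorem extendZero_koszulD {j : ℕ} (z : Koszul K n (j + 1)) :
    extendZero (koszulD K n j z) = signedBoundary (koszulSign K) (extendZero z) := by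
  ext1 J
  by_cases h : J.card = j
  · rw [← koszulD_apply z ⟨J, h⟩, ← extendZero_coe (koszulD K n j z) ⟨J, h⟩]
  · rw [extendZero_of_ne _ h]
    refine (Finset.sum_eq_zero fun k hk => ?_).symm
    rw [extendZero_of_ne, mul_zero]
    rw [Finset.card_insert_of_notMem (Finset.mem_compl.1 hk)]
    omega

theorem koszulD_koszulD {j : ℕ} (z : Koszul K n (j + 1 + 1)) :
    koszulD K n j (koszulD K n (j + 1) z) = 0 := by
  ext1 J
  rw [koszulD_apply, extendZero_koszulD, signedBoundary_signedBoundary antiSigns_koszulSign]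
  rfl

theorem koszulD_eq_of_signedBoundary {j : ℕ} {w : Finset (Fin n) → Poly K n}
    {y : Koszul K n j} (h : ∀ J : {J : Finset (Fin n) // J.card = j},
      signedBoundary (koszulSign K) w J.1 = y J) :
    koszulD K n j (fun T => w T.1) = y := by
  ext1 J
  rw [koszulD_apply, ← h J]
  refine Finset.sum_congr rfl fun k hk => ?_
  have hc : (insert k J.1).card = j + 1 := by
    rw [Finset.card_insert_of_notMem (Finset.mem_compl.1 hk), J.2]
  rw [extendZero, dif_pos hc]

/-- The Koszul complex of the variables is exact in positive degrees. -/
theorem ker_koszulD (j : ℕ) : LinearMap.ker (koszulD K n j) = syz K n (j + 1) := by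
  apply le_antisymm
  · intro z hz
    rw [LinearMap.mem_ker] at hz
    obtain ⟨w, hw⟩ := exists_signedBoundary_eq antiSigns_koszulSign (extendZero z)
      (fun J => by
        rw [← extendZero_koszulD, hz]
        simp [extendZero])
      (extendZero_of_ne _ (by simp))
    exact ⟨fun T => w T.1, koszulD_eq_of_signedBoundary fun J => by rw [hw, extendZero_coe]⟩
  · rintro _ ⟨z, rfl⟩
    exact koszulD_koszulD z

theorem koszulD_single_apply {j : ℕ} (T : {J : Finset (Fin n) // J.card = j + 1})
    (J : {J : Finset (Fin n) // J.card = j}) :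
    koszulD K n j (Pi.single T 1) J =
      ∑ k ∈ T.1, if J.1 = T.1.erase k then C (koszulSign K k J.1) * X k else 0 := by
  rw [koszulD_apply, signedBoundary, ← Finset.sum_filter]
  have : ∀ k ∈ J.1ᶜ, C (koszulSign K k J.1) * X k * extendZero (Pi.single T 1) (insert k J.1) =
      if insert k J.1 = T.1 then (C (koszulSign K k J.1) * X k : Poly K n) else 0 := by
    intro k hk
    have hc : (insert k J.1).card = j + 1 := by
      rw [Finset.card_insert_of_notMem (Finset.mem_compl.1 hk), J.2]
    rw [extendZero, dif_pos hc, Pi.single_apply]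
    simp only [Subtype.ext_iff]
    split_ifs <;> simp
  rw [Finset.sum_congr rfl this, ← Finset.sum_filter]
  refine Finset.sum_congr ?_ fun _ _ => rfl
  ext k
  simp only [Finset.mem_filter, Finset.mem_compl]
  constructor
  · rintro ⟨h1, h2⟩
    exact ⟨h2 ▸ Finset.mem_insert_self _ _, by rw [← h2, Finset.erase_insert h1]⟩
  · rintro ⟨h1, h2⟩
    rw [h2]
    exact ⟨Finset.notMem_erase _ _, Finset.insert_erase h1⟩

theorem linearMap_apply_eq_sum {ι : Type*} [Fintype ι] [DecidableEq ι]
    (ψ : (ι → Poly K n) →ₗ[Poly K n] Poly K n) (z : ι → Poly K n) :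
    ψ z = ∑ J, z J * ψ (Pi.single J 1) := by
  conv_lhs => rw [pi_eq_sum_univ' z]
  simp only [map_sum, map_smul, smul_eq_mul]

theorem linearMap_koszulD_single {j : ℕ} (ψ : Koszul K n j →ₗ[Poly K n] Poly K n)
    (T : {J : Finset (Fin n) // J.card = j + 1}) :
    ψ (koszulD K n j (Pi.single T 1)) = ∑ k ∈ T.1, C (koszulSign K k (T.1.erase k)) * X k *
      extendZero (fun J => ψ (Pi.single J 1)) (T.1.erase k) := by
  rw [linearMap_apply_eq_sum ψ]
  simp only [koszulD_single_apply, Finset.sum_mul]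
  rw [Finset.sum_comm]
  refine Finset.sum_congr rfl fun k hk => ?_
  have hc : (T.1.erase k).card = j := by rw [Finset.card_erase_of_mem hk, T.2]; rfl
  rw [Finset.sum_eq_single ⟨T.1.erase k, hc⟩]
  · rw [if_pos rfl, extendZero, dif_pos hc]
  · intro J _ hJ
    rw [if_neg, zero_mul]
    exact fun h => hJ (Subtype.ext h)
  · intro h
    exact absurd (Finset.mem_univ _) h

/-- The dual of the Koszul complex is exact below the top degree. -/
theorem exists_comp_koszulD {j : ℕ} (hj : j + 1 < n)
    (φ : Koszul K n (j + 1) →ₗ[Poly K n] Poly K n) (hφ : φ ∘ₗ koszulD K n (j + 1) = 0) :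
    ∃ ψ : Koszul K n j →ₗ[Poly K n] Poly K n, φ = ψ ∘ₗ koszulD K n j := by
  set v := extendZero (fun J => φ (Pi.single J 1)) with hv
  -- The cycle condition at `J` is the vanishing of `φ ∘ ∂` on the basis element indexed by `Jᶜ`.
  -- The value at `∅` is that of `v` at `[n]`, which is zero because `j + 1 < n`.
  obtain ⟨w, hw⟩ := exists_signedBoundary_eq antiSigns_compl (K := K) (fun J => v Jᶜ)
    (fun J => by
      by_cases hc : Jᶜ.card = j + 1 + 1
      · have h := linearMap_koszulD_single φ ⟨Jᶜ, hc⟩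
        rw [← LinearMap.comp_apply, hφ, LinearMap.zero_apply] at h
        rw [h, signedBoundary]
        refine Finset.sum_congr rfl fun k hk => ?_
        rw [hv, Finset.compl_insert]
      · refine Finset.sum_eq_zero fun k hk => ?_
        beta_reduce
        rw [hv, extendZero_of_ne, mul_zero]
        rw [Finset.compl_insert, Finset.card_erase_of_mem hk]
        have := Finset.card_pos.2 ⟨k, hk⟩
        omega)
    (by
      rw [hv, extendZero_of_ne]
      simp
      omega)
  refine ⟨Fintype.linearCombination (Poly K n) (fun J => w J.1ᶜ), ?_⟩
  refine LinearMap.pi_ext' fun T => LinearMap.ext_ring ?_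
  simp only [LinearMap.comp_apply, LinearMap.single_apply]
  rw [linearMap_koszulD_single]
  have h := hw T.1ᶜ
  simp only [compl_compl] at h
  rw [hv, extendZero_coe] at h
  rw [← h, signedBoundary]
  simp only [compl_compl]
  refine Finset.sum_congr rfl fun k hk => ?_
  have hc : (T.1.erase k).card = j := by rw [Finset.card_erase_of_mem hk, T.2]; rfl
  rw [extendZero, dif_pos hc, Fintype.linearCombination_apply_single, one_smul,
    Finset.compl_erase]

end KoszulExact

/-! ### The module `𝒜` as the image of the transposed differential. -/

section DualModule

variable {K : Type*} [Field K] {n t : ℕ}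

theorem card_filter_lt_orderEmbOfFin {L : Finset (Fin n)} {s : ℕ} (hL : L.card = s) (j : Fin s) :
    (L.filter (fun l => l < L.orderEmbOfFin hL j)).card = j := by
  have : L.filter (fun l => l < L.orderEmbOfFin hL j) =
      (Finset.univ.filter (fun i => i < j)).map (L.orderEmbOfFin hL).toEmbedding := by
    ext l
    simp only [Finset.mem_filter, Finset.mem_map, Finset.mem_univ, true_and]
    constructor
    · rintro ⟨h1, h2⟩
      obtain ⟨i, rfl⟩ : l ∈ Set.range (L.orderEmbOfFin hL) := by
        rw [Finset.range_orderEmbOfFin]; exact h1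
      exact ⟨i, by simpa using h2, rfl⟩
    · rintro ⟨i, hi, rfl⟩
      exact ⟨Finset.orderEmbOfFin_mem _ _ _, by simpa using hi⟩
  have h2 : Finset.univ.filter (fun i => i < j) = Finset.Iio j := by
    ext; simp
  rw [this, Finset.card_map, h2, Fin.card_Iio]

/-- Moving `i` from the left set to the right one loses the inversions `(i, l)` with `l ∉ L`, `l <
i`, and gains the inversions `(l, i)` with `l ∈ L`, `l > i`. -/
theorem card_inversions {L : Finset (Fin n)} {i : Fin n} (hi : i ∈ L) :
    (((L.erase i) ×ˢ (insert i Lᶜ)).filter (fun r => r.2 < r.1)).card +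
      (Lᶜ.filter (fun l => l < i)).card =
    ((L ×ˢ Lᶜ).filter (fun r => r.2 < r.1)).card + (L.filter (fun l => i < l)).card := by
  have h : ∀ A B : Finset (Fin n), ((A ×ˢ B).filter (fun r => r.2 < r.1)).card =
      ∑ a ∈ A, (B.filter (fun b => b < a)).card := by
    intro A B
    rw [Finset.card_filter, Finset.sum_product]
    simp only [Finset.card_filter]
  have h2 : ∀ a, ((insert i Lᶜ).filter (fun b => b < a)).card =
      (if i < a then 1 else 0) + (Lᶜ.filter (fun b => b < a)).card := by
    intro a
    rw [Finset.filter_insert]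
    split_ifs
    · rw [Finset.card_insert_of_notMem (by simp [hi]), add_comm]
    · rw [zero_add]
  rw [h, h, Finset.sum_congr rfl (fun a _ => h2 a), Finset.sum_add_distrib, add_assoc,
    Finset.sum_erase_add _ _ hi, add_comm, Finset.card_filter, Finset.sum_erase _ (by simp)]

/-- The sign splits into a factor depending on `L` alone and the Koszul sign of `i`, because the
elements of `L` below and above `i` together number `|L| - 1`. -/
theorem neg_one_pow_add_card {L : Finset (Fin n)} {i : Fin n} (hi : i ∈ L) :
    ((-1) ^ ((L.filter (fun l => l < i)).card + 1 + 1) *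
      sgn K n (L.erase i) (insert i Lᶜ) : Poly K n) =
    (-1) ^ (((L ×ˢ Lᶜ).filter (fun r => r.2 < r.1)).card + L.card + 1) *
      C (koszulSign K i Lᶜ) := by
  have h1 := card_inversions hi
  have h2 : L.card = (L.filter (fun l => l < i)).card + (L.filter (fun l => i < l)).card + 1 := by
    have h3 : L = insert i (L.filter (fun l => l < i) ∪ L.filter (fun l => i < l)) := by
      ext l
      simp only [Finset.mem_insert, Finset.mem_union, Finset.mem_filter]
      rcases lt_trichotomy l i with h | h | h
      · simp [h, h.ne, h.not_gt]
      · simp [h, hi]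
      · simp [h, h.ne', h.not_gt]
    conv_lhs => rw [h3]
    rw [Finset.card_insert_of_notMem (by simp), Finset.card_union_of_disjoint]
    rw [Finset.disjoint_left]
    intro l h4 h5
    simp only [Finset.mem_filter] at h4 h5
    exact absurd (h4.2.trans h5.2) (lt_irrefl _)
  rw [map_koszulSign, sgn, ← pow_add, ← pow_add, neg_one_pow_eq_pow_mod_two]
  conv_rhs => rw [neg_one_pow_eq_pow_mod_two]
  congr 1
  omega

theorem genA_eq {L T : Finset (Fin n)} (hL : L.card = n - t) (hT : T.card = t) (hLT : Lᶜ = T) :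
    genA K n t L hL = ((-1) ^ (((L ×ˢ Lᶜ).filter (fun r => r.2 < r.1)).card + L.card + 1) :
      Poly K n) • (LinearMap.proj (R := Poly K n) (φ := fun _ => Poly K n) ⟨T, hT⟩ ∘ₗ
        koszulD K n t) := by
  refine LinearMap.ext fun z => ?_
  subst hLT
  simp only [LinearMap.smul_apply, LinearMap.comp_apply, LinearMap.proj_apply, koszulD_apply,
    smul_eq_mul, signedBoundary, genA, LinearMap.sum_apply, compl_compl, Finset.mul_sum]
  rw [← Finset.sum_coe_sort L, ← (L.orderIsoOfFin hL).toEquiv.sum_comp]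
  refine Finset.sum_congr rfl fun j _ => ?_
  have hmem := L.orderEmbOfFin_mem hL j
  have h := neg_one_pow_add_card (K := K) hmem
  rw [card_filter_lt_orderEmbOfFin] at h
  rw [h, ← extendZero_coe z]
  simp only [RelIso.coe_fn_toEquiv, Finset.coe_orderIsoOfFin_apply]
  ring

/-- `𝒜` consists of the linear forms that factor through `∂_{t+1}`. -/
theorem calA_eq_range (ht : t ≤ n) :
    calA K n t = LinearMap.range (LinearMap.lcomp (Poly K n) (Poly K n) (koszulD K n t)) := by
  apply le_antisymm
  · rw [calA, Submodule.span_le]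
    rintro _ ⟨L, hL, rfl⟩
    have hT : Lᶜ.card = t := by
      rw [Finset.card_compl, hL, Fintype.card_fin]; omega
    rw [genA_eq hL hT rfl]
    exact Submodule.smul_mem _ _ ⟨LinearMap.proj ⟨Lᶜ, hT⟩, rfl⟩
  · rintro _ ⟨ψ, rfl⟩
    have hψ : ψ = ∑ T, ψ (Pi.single T 1) • LinearMap.proj (R := Poly K n)
        (φ := fun _ : {J : Finset (Fin n) // J.card = t} => Poly K n) T := by
      refine LinearMap.ext fun z => ?_
      rw [linearMap_apply_eq_sum ψ]
      simp [mul_comm]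
    rw [hψ, map_sum]
    refine Submodule.sum_mem _ fun T _ => ?_
    rw [map_smul]
    refine Submodule.smul_mem _ _ ?_
    have hL : T.1ᶜ.card = n - t := by
      rw [Finset.card_compl, T.2, Fintype.card_fin]
    have h := genA_eq (K := K) hL T.2 (compl_compl _)
    have h2 := Submodule.smul_mem (calA K n t)
      ((-1) ^ (((T.1ᶜ ×ˢ T.1ᶜᶜ).filter (fun r => r.2 < r.1)).card + T.1ᶜ.card + 1))
      (Submodule.subset_span ⟨T.1ᶜ, hL, rfl⟩)
    rw [h, smul_smul, ← mul_pow, neg_one_mul, neg_neg, one_pow, one_smul] at h2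
    exact h2

/-- One direction is `∂² = 0`, the other is exactness of the dual complex at `K_{t+1}^*`. -/
theorem mem_calA_iff (ht : t + 2 ≤ n) {φ : Koszul K n (t + 1) →ₗ[Poly K n] Poly K n} :
    φ ∈ calA K n t ↔ syz K n (t + 1) ≤ LinearMap.ker φ := by
  rw [calA_eq_range (by omega)]
  constructor
  · rintro ⟨ψ, rfl⟩ _ ⟨z, rfl⟩
    simp [koszulD_koszulD]
  · intro h
    obtain ⟨ψ, hψ⟩ := exists_comp_koszulD (by omega) φ
      (LinearMap.ext fun z => h (LinearMap.mem_range_self _ z))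
    exact ⟨ψ, hψ.symm⟩

end DualModule

/-! ### Homogeneous components of polynomials. -/

section Components

variable {K : Type*} [Field K] {n : ℕ}

theorem mul_mem_polyDeg {f g : Poly K n} {d e : ℤ} (hf : f ∈ polyDeg d) (hg : g ∈ polyDeg e) :
    f * g ∈ polyDeg (d + e) := by
  classical
  intro m hm
  rw [coeff_mul] at hm
  obtain ⟨⟨a, b⟩, hab, h⟩ := Finset.exists_ne_zero_of_sum_ne_zero hm
  rw [Finset.HasAntidiagonal.mem_antidiagonal] at hab
  have h1 := hf a (left_ne_zero_of_mul h)
  have h2 := hg b (right_ne_zero_of_mul h)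
  rw [← hab, map_add, Nat.cast_add, h1, h2]

theorem monomial_mem_polyDeg (m : Fin n →₀ ℕ) (r : K) :
    monomial m r ∈ polyDeg (K := K) (n := n) m.degree := by
  classical
  intro m' hm'
  rw [coeff_monomial] at hm'
  split_ifs at hm' with h
  · rw [h]
  · exact absurd rfl hm'

theorem one_mem_polyDeg : (1 : Poly K n) ∈ polyDeg (K := K) (n := n) 0 := by
  simpa using monomial_mem_polyDeg (K := K) (0 : Fin n →₀ ℕ) 1

theorem C_mul_X_mem_polyDeg (r : K) (i : Fin n) :
    (C r * X i : Poly K n) ∈ polyDeg (K := K) (n := n) 1 := by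
  rw [C_mul_X_eq_monomial]
  simpa using monomial_mem_polyDeg (Finsupp.single i 1) r

theorem eq_C_of_mem_polyDeg {f : Poly K n} {d : ℤ} (hf : f ∈ polyDeg d) (h0 : coeff 0 f ≠ 0) :
    f = C (coeff 0 f) := by
  classical
  ext m
  rw [coeff_C]
  split_ifs with h
  · rw [h]
  · by_contra hm
    have h1 := hf m hm
    have h2 := hf 0 h0
    rw [← h2, Nat.cast_inj, map_zero, Finsupp.degree_eq_zero_iff] at h1
    exact h h1.symm

theorem isHomogeneous_of_mem_polyDeg {f : Poly K n} {d : ℤ} (hf : f ∈ polyDeg d) :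
    ∃ i : ℕ, f.IsHomogeneous i := by
  refine ⟨d.toNat, fun m hm => ?_⟩
  have h := hf m hm
  change Finsupp.weight (fun _ => 1) m = _
  rw [← Finsupp.degree_eq_weight_one]
  omega

/-- The projection of `S` onto its homogeneous component of degree `d`. -/
def polyComp (d : ℤ) : Poly K n →ₗ[K] Poly K n :=
  -- Without the case distinction, `toNat` would send negative degrees to the constants.
  if 0 ≤ d then homogeneousComponent d.toNat else 0

theorem coeff_polyComp (d : ℤ) (f : Poly K n) (m : Fin n →₀ ℕ) :
    coeff m (polyComp d f) = if (m.degree : ℤ) = d then coeff m f else 0 := by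
  rw [polyComp]
  split_ifs with h1 h2 h2
  · rw [coeff_homogeneousComponent, if_pos (by omega)]
  · rw [coeff_homogeneousComponent, if_neg (by omega)]
  · omega
  · simp

theorem polyComp_mem (d : ℤ) (f : Poly K n) : polyComp d f ∈ polyDeg d := by
  intro m hm
  rw [coeff_polyComp] at hm
  by_contra h
  exact hm (if_neg h)

theorem polyComp_of_mem {d : ℤ} {f : Poly K n} (hf : f ∈ polyDeg d) (e : ℤ) :
    polyComp e f = if e = d then f else 0 := by
  ext m
  rw [coeff_polyComp]
  by_cases h0 : coeff m f = 0
  · split_ifs <;> simp [h0]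
  · rw [hf m h0]
    split_ifs with h1 h2 h2
    · rfl
    · exact absurd h1.symm h2
    · exact absurd h2.symm h1
    · simp

end Components

/-! ### Homogeneous components in graded free modules and homogeneous preimages. -/

section FreeComponents

variable {K : Type*} [Field K] {n : ℕ} {ι κ : Type*}

/-- The projection of `⊕ i, S(-a i)` onto its homogeneous component of degree `d`. -/
def freeComp (a : ι → ℤ) (d : ℤ) : (ι → Poly K n) →ₗ[K] (ι → Poly K n) :=
  LinearMap.pi fun i => polyComp (-(a i) + d) ∘ₗ LinearMap.proj i

theorem freeComp_mem (a : ι → ℤ) (d : ℤ) (v : ι → Poly K n) : freeComp a d v ∈ freeDeg a d :=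
  fun _ => polyComp_mem _ _

theorem freeComp_of_mem {a : ι → ℤ} {d : ℤ} {v : ι → Poly K n} (hv : v ∈ freeDeg a d) (e : ℤ) :
    freeComp a e v = if e = d then v else 0 := by
  ext1 i
  have h : freeComp a e v i = polyComp (-(a i) + e) (v i) := rfl
  rw [h, polyComp_of_mem (hv i)]
  by_cases he : e = d
  · rw [if_pos he, if_pos (by omega)]
  · rw [if_neg he, if_neg (by omega)]
    rfl

theorem smul_mem_freeDeg {a : ι → ℤ} {f : Poly K n} {v : ι → Poly K n} {d e : ℤ}
    (hf : f ∈ polyDeg d) (hv : v ∈ freeDeg a e) : f • v ∈ freeDeg a (d + e) := by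
  intro i
  have h := mul_mem_polyDeg hf (hv i)
  have he : d + (-(a i) + e) = -(a i) + (d + e) := by ring
  rw [he] at h
  exact h

theorem single_one_mem_freeDeg [DecidableEq ι] (a : ι → ℤ) (i : ι) :
    (Pi.single i 1 : ι → Poly K n) ∈ freeDeg a (a i) := by
  intro j
  rw [Pi.single_apply]
  split_ifs with h
  · subst h
    change (1 : Poly K n) ∈ polyDeg (-(a j) + a j)
    rw [neg_add_cancel]
    exact one_mem_polyDeg
  · exact zero_mem _

theorem isOfDegree_of_single [Fintype ι] [DecidableEq ι] {a : ι → ℤ} {b : κ → ℤ} {e : ℤ}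
    {f : (ι → Poly K n) →ₗ[Poly K n] (κ → Poly K n)}
    (hf : ∀ i, f (Pi.single i 1) ∈ freeDeg b (e + a i)) :
    IsOfDegree (freeDeg (K := K) a) (freeDeg (K := K) b) e f := by
  intro d v hv
  rw [pi_eq_sum_univ' v, map_sum]
  refine Submodule.sum_mem _ fun i _ => ?_
  rw [map_smul]
  have h := smul_mem_freeDeg (hv i) (hf i)
  have he : -(a i) + d + (e + a i) = e + d := by ring
  rw [he] at h
  exact h

theorem map_freeComp [Fintype ι] [DecidableEq ι] {a : ι → ℤ} {b : κ → ℤ} {e : ℤ}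
    {f : (ι → Poly K n) →ₗ[Poly K n] (κ → Poly K n)}
    (hf : IsOfDegree (freeDeg (K := K) a) (freeDeg (K := K) b) e f) (d : ℤ) (v : ι → Poly K n) :
    f (freeComp a d v) = freeComp b (e + d) (f v) := by
  suffices h : f.restrictScalars K ∘ₗ freeComp a d = freeComp b (e + d) ∘ₗ f.restrictScalars K from
    LinearMap.congr_fun h v
  refine LinearMap.pi_ext' fun i => MvPolynomial.linearMap_ext fun m => LinearMap.ext fun r => ?_
  have h0 : (Pi.single i (monomial m r) : ι → Poly K n) ∈ freeDeg a ((m.degree : ℤ) + a i) := by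
    have h := smul_mem_freeDeg (monomial_mem_polyDeg m r) (single_one_mem_freeDeg (K := K) a i)
    rwa [← Pi.single_smul, smul_eq_mul, mul_one] at h
  simp only [LinearMap.comp_apply, LinearMap.restrictScalars_apply, LinearMap.single_apply]
  rw [freeComp_of_mem h0, freeComp_of_mem (hf _ _ h0)]
  by_cases hd : d = (m.degree : ℤ) + a i
  · rw [if_pos hd, if_pos (by omega)]
  · rw [if_neg hd, if_neg (by omega), map_zero]

/-- Homogeneous elements in the range of a homogeneous map have homogeneous preimages. -/
theorem exists_homogeneous_preimage [Fintype ι] [DecidableEq ι] {a : ι → ℤ} {b : κ → ℤ}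
    {f : (ι → Poly K n) →ₗ[Poly K n] (κ → Poly K n)}
    (hf : IsOfDegree (freeDeg (K := K) a) (freeDeg (K := K) b) 0 f) {d : ℤ} {x : κ → Poly K n}
    (hx : x ∈ freeDeg b d) (hxf : x ∈ LinearMap.range f) : ∃ y ∈ freeDeg a d, f y = x := by
  obtain ⟨y, rfl⟩ := hxf
  -- Projection to degree `d` commutes with `f` and fixes `x`.
  refine ⟨freeComp a d y, freeComp_mem a d y, ?_⟩
  rw [map_freeComp hf, freeComp_of_mem hx, if_pos (zero_add d)]

theorem isOfDegree_koszulD (j : ℕ) :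
    IsOfDegree (koszulDeg K n (j + 1)) (koszulDeg K n j) 0 (koszulD K n j) := by
  refine isOfDegree_of_single fun T J => ?_
  rw [koszulD_single_apply]
  change _ ∈ polyDeg (-(j : ℤ) + (0 + ((j + 1 : ℕ) : ℤ)))
  have h : -(j : ℤ) + (0 + ((j + 1 : ℕ) : ℤ)) = 1 := by push_cast; ring
  rw [h]
  refine Submodule.sum_mem _ fun k _ => ?_
  split_ifs
  · exact C_mul_X_mem_polyDeg _ _
  · exact zero_mem _

attribute [local instance] MvPolynomial.gradedAlgebra in
theorem isGradedIdeal_range {ι : Type*} [Fintype ι] [DecidableEq ι]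
    (φ : (ι → Poly K n) →ₗ[Poly K n] Poly K n) (d : ι → ℤ)
    (hφ : ∀ i, φ (Pi.single i 1) ∈ polyDeg (d i)) :
    IsGradedIdeal (LinearMap.range φ : Ideal (Poly K n)) := by
  have h : (LinearMap.range φ : Ideal (Poly K n)) =
      Ideal.span (Set.range fun i => φ (Pi.single i 1)) := by
    apply le_antisymm
    · rintro _ ⟨v, rfl⟩
      rw [linearMap_apply_eq_sum]
      exact Ideal.sum_mem _ fun i _ => Ideal.mul_mem_left _ _ (Ideal.subset_span ⟨i, rfl⟩)
    · rw [Ideal.span_le]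
      rintro _ ⟨i, rfl⟩
      exact LinearMap.mem_range_self φ _
  rw [IsGradedIdeal, h]
  refine Ideal.homogeneous_span _ _ ?_
  rintro _ ⟨i, rfl⟩
  exact isHomogeneous_of_mem_polyDeg (hφ i)

end FreeComponents

/-! ### Ranks of the syzygy modules and the projective dimension bound. -/

section Rank

theorem finrank_range_add_finrank_ker {R : Type*} [CommRing R] [IsDomain R] {M N : Type*}
    [AddCommGroup M] [Module R M] [Module.Finite R M] [AddCommGroup N] [Module R N]
    (f : M →ₗ[R] N) :
    Module.finrank R (LinearMap.range f) + Module.finrank R (LinearMap.ker f) =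
      Module.finrank R M := by
  rw [← f.quotKerEquivRange.finrank_eq]
  exact Submodule.finrank_quotient_add_finrank _

theorem finrank_of_exact {R : Type*} [CommRing R] [IsDomain R] [IsNoetherianRing R]
    {F G E I : Type*} [AddCommGroup F] [Module R F] [Module.Finite R F]
    [AddCommGroup G] [Module R G] [Module.Finite R G] [AddCommGroup E] [Module R E]
    [Module.Finite R E] [AddCommGroup I] [Module R I] {f : F →ₗ[R] G} {g : G →ₗ[R] E}
    {h : E →ₗ[R] I} (hf : Function.Injective f) (hfg : Function.Exact f g)
    (hgh : Function.Exact g h) (hh : Function.Surjective h) :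
    Module.finrank R F + Module.finrank R E = Module.finrank R G + Module.finrank R I := by
  have h1 := finrank_range_add_finrank_ker g
  have h2 := finrank_range_add_finrank_ker h
  rw [LinearMap.exact_iff.1 hfg, LinearMap.finrank_range_of_inj hf] at h1
  rw [LinearMap.exact_iff.1 hgh, LinearMap.range_eq_top.2 hh, finrank_top] at h2
  omega

variable {K : Type*} [Field K] {n : ℕ}

/-- The surjection `K_{j+1} → E_{j+1}`. -/
def toSyz (K : Type*) [Field K] (n j : ℕ) : Koszul K n (j + 1) →ₗ[Poly K n] syz K n j :=
  (koszulD K n j).rangeRestrict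

@[simp] theorem coe_toSyz (j : ℕ) (x : Koszul K n (j + 1)) :
    (toSyz K n j x : Koszul K n j) = koszulD K n j x := rfl

theorem toSyz_surjective (j : ℕ) : Function.Surjective (toSyz K n j) :=
  LinearMap.surjective_rangeRestrict _

theorem toSyz_eq_zero_iff {j : ℕ} {x : Koszul K n (j + 1)} :
    toSyz K n j x = 0 ↔ x ∈ syz K n (j + 1) := by
  rw [← ker_koszulD, LinearMap.mem_ker, ← coe_toSyz, Submodule.coe_eq_zero]

theorem finrank_koszul (j : ℕ) : Module.finrank (Poly K n) (Koszul K n j) = n.choose j := by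
  rw [Module.finrank_fintype_fun_eq_card, Fintype.card_finset_len, Fintype.card_fin]

theorem finrank_ideal {I : Ideal (Poly K n)} (hI : I ≠ ⊥) : Module.finrank (Poly K n) I = 1 := by
  apply le_antisymm
  · simpa using Submodule.finrank_le I
  · have := Submodule.nontrivial_iff_ne_bot.2 hI
    exact Module.finrank_pos

theorem coeff_koszulD_single {j : ℕ} (T : {J : Finset (Fin n) // J.card = j + 1}) {k : Fin n}
    (hk : k ∈ T.1) :
    coeff (Finsupp.single k 1) (koszulD K n j (Pi.single T 1)
      ⟨T.1.erase k, by rw [Finset.card_erase_of_mem hk, T.2]; rfl⟩) ≠ 0 := by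
  rw [koszulD_single_apply, Finset.sum_eq_single k]
  · rw [if_pos rfl, coeff_C_mul, coeff_X, if_pos rfl, mul_one]
    exact left_ne_zero_of_mul_eq_one (koszulSign_mul_self _ _)
  · intro l hl hlk
    rw [if_neg]
    intro h
    have : l ∈ T.1.erase k := Finset.mem_erase.2 ⟨hlk, hl⟩
    dsimp only at h
    rw [h] at this
    exact absurd this (Finset.notMem_erase _ _)
  · exact fun h => absurd hk h

/-- The entries of `∂` are linear forms, so `∂` maps `𝔪 K_{j+1}` into `𝔪² K_j`. -/
theorem coeff_single_koszulD {j : ℕ} {v : Koszul K n (j + 1)} (hv : ∀ J, coeff 0 (v J) = 0)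
    (J : {J : Finset (Fin n) // J.card = j}) (k : Fin n) :
    coeff (Finsupp.single k 1) (koszulD K n j v J) = 0 := by
  rw [koszulD_apply, coeff_signedBoundary]
  refine Finset.sum_eq_zero fun l hl => ?_
  split_ifs with h
  · have hc : (insert l J.1).card = j + 1 := by
      rw [Finset.card_insert_of_notMem (Finset.mem_compl.1 hl), J.2]
    have hlk : l = k := by
      by_contra hne
      exact h (Finsupp.single_eq_of_ne hne)
    rw [hlk, tsub_self, ← hlk, extendZero, dif_pos hc, hv, mul_zero]
  · rfl

theorem koszulD_ne_zero {j : ℕ} (hj : j + 1 ≤ n) : koszulD K n j ≠ 0 := by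
  obtain ⟨T, -, hT⟩ := Finset.exists_subset_card_eq (s := (Finset.univ : Finset (Fin n)))
    (n := j + 1) (by simpa using hj)
  obtain ⟨k, hk⟩ : T.Nonempty := Finset.card_pos.1 (by omega)
  intro h
  apply coeff_koszulD_single (K := K) ⟨T, hT⟩ hk
  rw [h]
  simp

theorem finrank_syz (hn : 1 ≤ n) (j : ℕ) :
    Module.finrank (Poly K n) (syz K n j) = (n - 1).choose j := by
  obtain ⟨n, rfl⟩ : ∃ m, n = m + 1 := ⟨n - 1, by omega⟩
  induction j with
  | zero =>
    apply le_antisymm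
    · have := Submodule.finrank_le (syz K (n + 1) 0)
      rw [finrank_koszul] at this
      simpa using this
    · have : Nontrivial (syz K (n + 1) 0) := by
        rw [Submodule.nontrivial_iff_ne_bot, syz, ne_eq, LinearMap.range_eq_bot]
        exact koszulD_ne_zero hn
      rw [Nat.choose_zero_right]
      exact (Module.finrank_pos : 0 < Module.finrank (Poly K (n + 1)) (syz K (n + 1) 0))
  | succ j ih =>
    have h := finrank_range_add_finrank_ker (koszulD K (n + 1) j)
    -- By exactness the ranks of consecutive syzygy modules add up to a binomial coefficient;
    -- Pascal's rule does the rest.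
    rw [ker_koszulD, finrank_koszul, ← syz, ih, Nat.choose_succ_succ] at h
    simpa using h

/-- A section `s` makes `id - s ∂` a projection onto `E_{j+2}`, so `e_J - s ∂ e_J = ∂ w_J`. Applied
to `y = ∂ e_T` this gives `y = ∂ (∑ y_J w_J)` with all `y_J ∈ 𝔪`, so `y` would have no linear terms;
but `∂ e_T` has them. -/
theorem no_section_koszulD {j : ℕ} (hj : j + 2 ≤ n)
    (s : syz K n j →ₗ[Poly K n] Koszul K n (j + 1)) : ¬ ∀ x, koszulD K n j (s x) = x := by
  intro hs
  obtain ⟨T, -, hT⟩ := Finset.exists_subset_card_eq (s := (Finset.univ : Finset (Fin n)))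
    (n := j + 1 + 1) (by simpa [Nat.succ_le_iff] using hj)
  obtain ⟨k, hk⟩ : T.Nonempty := Finset.card_pos.1 (by omega)
  have hr : ∀ J, ∃ w, koszulD K n (j + 1) w = Pi.single J 1 - s (toSyz K n j (Pi.single J 1)) := by
    intro J
    change _ ∈ syz K n (j + 1)
    rw [← ker_koszulD, LinearMap.mem_ker, map_sub, hs, coe_toSyz, sub_self]
  choose w hw using hr
  set y := koszulD K n (j + 1) (Pi.single ⟨T, hT⟩ 1) with hy
  have hy0 : toSyz K n j y = 0 := toSyz_eq_zero_iff.2 (LinearMap.mem_range_self _ _)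
  have h : koszulD K n (j + 1) (∑ J, y J • w J) = y := by
    have h1 : y = ∑ J, y J • Pi.single J 1 := pi_eq_sum_univ' y
    have h2 : s (toSyz K n j y) = ∑ J, y J • s (toSyz K n j (Pi.single J 1)) := by
      conv_lhs => rw [h1]
      simp only [map_sum, map_smul]
    rw [hy0, map_zero] at h2
    rw [map_sum]
    simp only [map_smul, hw, smul_sub, Finset.sum_sub_distrib]
    rw [← h1, ← h2, sub_zero]
  refine coeff_koszulD_single (K := K) ⟨T, hT⟩ hk ?_
  rw [← hy, ← h]
  refine coeff_single_koszulD (fun U => ?_) _ _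
  rw [Finset.sum_apply, coeff_sum]
  refine Finset.sum_eq_zero fun J _ => ?_
  have h0 : constantCoeff (y J) = 0 := by
    rw [hy, koszulD_single_apply, map_sum]
    refine Finset.sum_eq_zero fun k _ => ?_
    split_ifs <;> simp
  rw [Pi.smul_apply, smul_eq_mul, ← constantCoeff_eq, map_mul, h0, zero_mul]

/-- `E_{t+1}` has projective dimension at least two for `t + 2 < n`. -/
theorem not_exact_of_lt {t : ℕ} (ht : t + 2 < n) {p q : ℕ}
    {f : (Fin p → Poly K n) →ₗ[Poly K n] (Fin q → Poly K n)}
    {g : (Fin q → Poly K n) →ₗ[Poly K n] syz K n t} (hf : Function.Injective f)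
    (hfg : Function.Exact f g) (hg : Function.Surjective g) : False := by
  set π := toSyz K n t with hπ
  have hπs : Function.Surjective π := toSyz_surjective _
  -- Comparison with `0 → E_{t+2} → K_{t+1} → E_{t+1} → 0`: the maps `u`, `v` lift the identity of
  -- `E_{t+1}`, `w` lifts `v ∘ f` to `K_{t+2}`, and `r` lifts `id - v ∘ u` to `K_{t+2}`.
  obtain ⟨u, hu⟩ := Module.projective_lifting_property g π hg
  obtain ⟨v, hv⟩ := Module.projective_lifting_property π g hπs
  have hu' : ∀ x, g (u x) = π x := fun x => LinearMap.congr_fun hu x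
  have hv' : ∀ x, π (v x) = g x := fun x => LinearMap.congr_fun hv x
  obtain ⟨w, hw⟩ := Module.projective_lifting_property (toSyz K n (t + 1))
    ((v ∘ₗ f).codRestrict (syz K n (t + 1))
      fun x => toSyz_eq_zero_iff.1 (by rw [LinearMap.comp_apply, hv', hfg.apply_apply_eq_zero]))
    (toSyz_surjective _)
  obtain ⟨r, hr⟩ := Module.projective_lifting_property (toSyz K n (t + 1))
    ((LinearMap.id - v ∘ₗ u).codRestrict (syz K n (t + 1))
      fun x => toSyz_eq_zero_iff.1 (by simp [← hπ, hv', hu']))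
    (toSyz_surjective _)
  have hw' : ∀ x, koszulD K n (t + 1) (w x) = v (f x) :=
    fun x => congrArg Subtype.val (LinearMap.congr_fun hw x)
  have hr' : ∀ x, koszulD K n (t + 1) (r x) = x - v (u x) :=
    fun x => congrArg Subtype.val (LinearMap.congr_fun hr x)
  have hm : ∀ x : syz K n (t + 1), u x.1 ∈ LinearMap.range f := by
    intro x
    refine (hfg (u x.1)).1 ?_
    rw [hu']
    exact toSyz_eq_zero_iff.2 x.2
  let e := LinearEquiv.ofInjective f hf
  let k : syz K n (t + 1) →ₗ[Poly K n] (Fin p → Poly K n) :=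
    e.symm.toLinearMap ∘ₗ (u ∘ₗ (syz K n (t + 1)).subtype).codRestrict (LinearMap.range f) hm
  have hk : ∀ x, f (k x) = u x.1 := by
    intro x
    exact congrArg Subtype.val (e.apply_symm_apply ⟨u x.1, hm x⟩)
  -- On `E_{t+2}` one has `x = ∂ r x + v u x` and `v u x = v f k x = ∂ w k x`, so `r + w k` is a
  -- section.
  refine no_section_koszulD (K := K) (n := n) (j := t + 1) (by omega)
    (r ∘ₗ (syz K n (t + 1)).subtype + w ∘ₗ k) fun x => ?_
  simp [hw', hr', hk]

end Rank

/-! ### Translation between Bourbaki sequences and pairs `(β, φ)`. -/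

section Equivalence

variable {K : Type*} [Field K] {n t p q : ℕ} {a : Fin p → ℤ} {b : Fin q → ℤ} {c : ℤ}

/-- If `I = 0`, then `g` is onto and the sequence is a free resolution of `E_{t+1}` of length one.
-/
theorem IsBourbakiSeq.ideal_ne_bot {I : Ideal (Poly K n)}
    {f : (Fin p → Poly K n) →ₗ[Poly K n] (Fin q → Poly K n)}
    {g : (Fin q → Poly K n) →ₗ[Poly K n] syz K n t} {h : syz K n t →ₗ[Poly K n] I}
    (H : IsBourbakiSeq t a b c I f g h) (ht : t + 2 < n) : I ≠ ⊥ := by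
  rintro rfl
  refine not_exact_of_lt ht H.injective H.exact_fg fun x => (H.exact_gh x).1 ?_
  exact Subsingleton.elim _ _

theorem finrank_euler {I : Ideal (Poly K n)} (hn : 1 ≤ n)
    {f : (Fin p → Poly K n) →ₗ[Poly K n] (Fin q → Poly K n)}
    {g : (Fin q → Poly K n) →ₗ[Poly K n] syz K n t} {h : syz K n t →ₗ[Poly K n] I}
    (H : IsBourbakiSeq t a b c I f g h) :
    p + (n - 1).choose t = q + Module.finrank (Poly K n) I := by
  have h1 := finrank_of_exact H.injective H.exact_fg H.exact_gh H.surjective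
  simpa [finrank_syz hn] using h1

theorem IsBourbakiSeq.exists_datum {I : Ideal (Poly K n)} (ht : t + 2 ≤ n)
    (hI : n = t + 2 → I ≠ ⊥)
    {f : (Fin p → Poly K n) →ₗ[Poly K n] (Fin q → Poly K n)}
    {g : (Fin q → Poly K n) →ₗ[Poly K n] syz K n t} {h : syz K n t →ₗ[Poly K n] I}
    (H : IsBourbakiSeq t a b c I f g h) (hg : ∀ i, g (Pi.single i 1) ≠ 0) :
    ∃ (β : Fin q → Koszul K n (t + 1)) (φ : Koszul K n (t + 1) →ₗ[Poly K n] Poly K n),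
      IsBourbakiDatum t a b c β φ ∧ I = LinearMap.range φ := by
  have hI' : I ≠ ⊥ := by
    rcases eq_or_lt_of_le ht with h | h
    · exact hI h.symm
    · exact H.ideal_ne_bot h
  have hβ : ∀ i, ∃ y ∈ koszulDeg K n (t + 1) (b i), koszulD K n t y = g (Pi.single i 1) := by
    intro i
    have h1 := H.degree_g (b i) _ (single_one_mem_freeDeg b i)
    rw [zero_add] at h1
    exact exists_homogeneous_preimage (isOfDegree_koszulD t) h1 (g (Pi.single i 1)).2
  choose β hβd hβ using hβ
  set B := Fintype.linearCombination (Poly K n) β with hB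
  have hBr : LinearMap.range B = Submodule.span (Poly K n) (Set.range β) :=
    Fintype.range_linearCombination _ _
  have hBg : toSyz K n t ∘ₗ B = g := by
    refine LinearMap.pi_ext' fun i => LinearMap.ext_ring (Subtype.ext ?_)
    simp [hB, hβ]
  have hBg' : ∀ v, toSyz K n t (B v) = g v := fun v => LinearMap.congr_fun hBg v
  have hker : ∀ x, (I.subtype ∘ₗ h ∘ₗ toSyz K n t) x = 0 ↔ ∃ v, g v = toSyz K n t x := by
    intro x
    rw [LinearMap.comp_apply, LinearMap.comp_apply, Submodule.subtype_apply,
      Submodule.coe_eq_zero, H.exact_gh]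
    rfl
  refine ⟨β, I.subtype ∘ₗ h ∘ₗ toSyz K n t, ?_, ?_⟩
  · refine ⟨hβd, fun i hi => ?_, ?_, ?_, ?_, ?_, ?_⟩
    · refine hg i (Subtype.ext ?_)
      rw [← hβ, ← coe_toSyz, toSyz_eq_zero_iff.2 hi]
    · rw [mem_calA_iff ht]
      intro x hx
      rw [LinearMap.mem_ker, hker, toSyz_eq_zero_iff.2 hx]
      exact ⟨0, map_zero g⟩
    · intro d x hx
      have h1 := isOfDegree_koszulD t d x hx
      have h2 := H.degree_h (0 + d) (toSyz K n t x) h1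
      have h3 : c + (0 + (0 + d)) = -(n : ℤ) + (n + c + d) := by ring
      change _ ∈ polyDeg (-(n : ℤ) + (n + c + d))
      rw [← h3]
      exact h2
    · ext x
      rw [LinearMap.mem_ker, hker, Submodule.mem_sup, ← hBr]
      constructor
      · rintro ⟨v, hv⟩
        refine ⟨B v, LinearMap.mem_range_self _ v, x - B v, ?_, by abel⟩
        rw [← toSyz_eq_zero_iff, map_sub, hBg', hv, sub_self]
      · rintro ⟨_, ⟨v, rfl⟩, z, hz, rfl⟩
        exact ⟨v, by rw [map_add, hBg', toSyz_eq_zero_iff.2 hz, add_zero]⟩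
    -- Here `I ≠ 0` enters, through `rank I = 1`.
    · have := finrank_euler (by omega) H
      rw [finrank_ideal hI'] at this
      have h2 : ((p + (n - 1).choose t : ℕ) : ℤ) = ((q + 1 : ℕ) : ℤ) := by rw [this]
      push_cast at h2
      linarith
    · refine ⟨f, H.degree_f, H.injective, ?_, ?_⟩
      · rw [← hB, ← hBr]
        ext x
        constructor
        · rintro ⟨u, rfl⟩
          refine ⟨LinearMap.mem_range_self _ (f u), ?_⟩
          rw [SetLike.mem_coe, ← toSyz_eq_zero_iff, LinearMap.comp_apply, hBg']
          exact H.exact_fg.apply_apply_eq_zero u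
        · rintro ⟨⟨v, rfl⟩, hv⟩
          rw [SetLike.mem_coe, ← toSyz_eq_zero_iff, hBg'] at hv
          obtain ⟨u, rfl⟩ := (H.exact_fg v).1 hv
          exact ⟨u, rfl⟩
      · rw [← hB]
        ext v
        constructor
        · rintro ⟨u, hu, rfl⟩
          exact hu
        · intro hv
          have hv' : B v = 0 := hv
          -- `Ker β` lies in `Ker g = Im f`, so the first row of the diagram is onto.
          obtain ⟨u, rfl⟩ := (H.exact_fg v).1 (by rw [← hBg', hv', map_zero])
          exact ⟨u, hv, rfl⟩
  · ext x
    constructor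
    · intro hx
      obtain ⟨y, hy⟩ := H.surjective ⟨x, hx⟩
      obtain ⟨z, rfl⟩ := toSyz_surjective t y
      exact ⟨z, congrArg Subtype.val hy⟩
    · rintro ⟨z, rfl⟩
      exact (h (toSyz K n t z)).2

theorem IsBourbakiDatum.exists_seq {β : Fin q → Koszul K n (t + 1)}
    {φ : Koszul K n (t + 1) →ₗ[Poly K n] Poly K n} (ht : t + 2 ≤ n)
    (H : IsBourbakiDatum t a b c β φ) :
    ∃ (f : (Fin p → Poly K n) →ₗ[Poly K n] (Fin q → Poly K n))
      (g : (Fin q → Poly K n) →ₗ[Poly K n] syz K n t)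
      (h : syz K n t →ₗ[Poly K n] (LinearMap.range φ : Ideal (Poly K n))),
      IsBourbakiSeq t a b c (LinearMap.range φ) f g h ∧ ∀ i, g (Pi.single i 1) ≠ 0 := by
  obtain ⟨ι, hι, hιi, hιr, hιk⟩ := H.diagram
  have hle := (mem_calA_iff ht).1 H.mem_calA
  set B := Fintype.linearCombination (Poly K n) β with hB
  have hBr : LinearMap.range B = Submodule.span (Poly K n) (Set.range β) :=
    Fintype.range_linearCombination _ _
  have hBd : IsOfDegree (freeDeg (K := K) b) (koszulDeg K n (t + 1)) 0 B := by
    refine isOfDegree_of_single fun i => ?_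
    rw [hB, Fintype.linearCombination_apply_single, one_smul, zero_add]
    exact H.degree_β i
  have hkerle : LinearMap.ker (toSyz K n t) ≤ LinearMap.ker φ := fun x hx =>
    hle (toSyz_eq_zero_iff.1 hx)
  -- `φ` descends to `E_{t+1} = K_{t+1} / E_{t+2}` because it vanishes on `E_{t+2}`.
  obtain ⟨h, hh⟩ : ∃ h : syz K n t →ₗ[Poly K n] (LinearMap.range φ : Ideal (Poly K n)),
      ∀ x, h (toSyz K n t x) = φ.rangeRestrict x := by
    refine ⟨(LinearMap.ker (toSyz K n t)).liftQ φ.rangeRestrict (fun x hx =>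
      Subtype.ext (hkerle hx)) ∘ₗ ((toSyz K n t).quotKerEquivOfSurjective
        (toSyz_surjective t)).symm.toLinearMap, fun x => ?_⟩
    have : ((toSyz K n t).quotKerEquivOfSurjective (toSyz_surjective t)).symm (toSyz K n t x) =
        Submodule.Quotient.mk x := by
      rw [LinearEquiv.symm_apply_eq]
      rfl
    rw [LinearMap.comp_apply, LinearEquiv.coe_coe, this]
    rfl
  have hh' : ∀ x, (h (toSyz K n t x) : Poly K n) = φ x := fun x => by rw [hh]; rfl
  refine ⟨ι, toSyz K n t ∘ₗ B, h, ⟨hι, ?_, ?_, hιi, ?_, ?_, ?_⟩, ?_⟩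
  · intro d x hx
    have h1 := isOfDegree_koszulD t _ _ (hBd d x hx)
    rw [zero_add] at h1
    exact h1
  · rintro d ⟨x, hx⟩ hxd
    obtain ⟨y, hy, rfl⟩ := exists_homogeneous_preimage (isOfDegree_koszulD t) hxd hx
    have h1 := H.degree_φ d y hy
    change (h (toSyz K n t y) : Poly K n) ∈ polyDeg (c + (0 + d))
    have h2 : c + (0 + d) = -(n : ℤ) + (n + c + d) := by ring
    rw [h2, hh']
    exact h1
  · intro v
    rw [LinearMap.comp_apply, toSyz_eq_zero_iff]
    constructor
    · intro hv
      -- A diagram chase: the columns give `u` with `β v = β ι u`, and the first row puts the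
      -- difference `v - ι u` into the image of `ι`.
      have h1 : B v ∈ LinearMap.range (B ∘ₗ ι) := by
        rw [hιr, ← hBr]
        exact ⟨LinearMap.mem_range_self _ v, hv⟩
      obtain ⟨u, hu⟩ := h1
      have h2 : v - ι u ∈ LinearMap.ker B := by
        rw [LinearMap.mem_ker, map_sub, ← hu, LinearMap.comp_apply, sub_self]
      rw [← hιk] at h2
      obtain ⟨w, -, hw⟩ := h2
      exact ⟨w + u, by rw [map_add, hw, sub_add_cancel]⟩
    · rintro ⟨u, rfl⟩
      have h1 := LinearMap.mem_range_self (B ∘ₗ ι) u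
      rw [hιr] at h1
      exact h1.2
  · intro x
    obtain ⟨y, rfl⟩ := toSyz_surjective t x
    rw [← Submodule.coe_eq_zero, hh', ← LinearMap.mem_ker, H.ker_φ, ← hBr, Submodule.mem_sup]
    constructor
    · rintro ⟨_, ⟨v, rfl⟩, z, hz, rfl⟩
      exact ⟨v, by rw [map_add, toSyz_eq_zero_iff.2 hz, add_zero]; rfl⟩
    · rintro ⟨v, hv⟩
      refine ⟨B v, LinearMap.mem_range_self _ v, y - B v, ?_, by abel⟩
      rw [← toSyz_eq_zero_iff, map_sub, ← hv, LinearMap.comp_apply, sub_self]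
  · rintro ⟨_, y, rfl⟩
    exact ⟨toSyz K n t y, hh y⟩
  · intro i hi
    rw [LinearMap.comp_apply, hB, Fintype.linearCombination_apply_single, one_smul,
      toSyz_eq_zero_iff] at hi
    exact H.notMem i hi

theorem IsBourbakiDatum.isGradedIdeal {β : Fin q → Koszul K n (t + 1)}
    {φ : Koszul K n (t + 1) →ₗ[Poly K n] Poly K n} (H : IsBourbakiDatum t a b c β φ) :
    IsGradedIdeal (LinearMap.range φ : Ideal (Poly K n)) :=
  isGradedIdeal_range φ _ fun J => H.degree_φ _ _ (single_one_mem_freeDeg _ J)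

/-- Comparing the prescribed value of `p` with the additivity of rank forces the image ideal to have
rank one. -/
theorem IsBourbakiDatum.range_ne_bot {β : Fin q → Koszul K n (t + 1)}
    {φ : Koszul K n (t + 1) →ₗ[Poly K n] Poly K n} (ht : t + 2 ≤ n)
    (H : IsBourbakiDatum t a b c β φ) : (LinearMap.range φ : Ideal (Poly K n)) ≠ ⊥ := by
  obtain ⟨f, g, h, hs, -⟩ := H.exists_seq ht
  intro h0
  have h1 := finrank_euler (by omega) hs
  rw [h0, finrank_bot] at h1
  have h2 := H.rank_eq
  omega

theorem bourbakiSeq_iff_datum (ht : t + 2 ≤ n) (I : Ideal (Poly K n)) :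
    (IsGradedIdeal I ∧ (n = t + 2 → I ≠ ⊥) ∧
        ∃ (f : (Fin p → Poly K n) →ₗ[Poly K n] (Fin q → Poly K n))
          (g : (Fin q → Poly K n) →ₗ[Poly K n] syz K n t) (h : syz K n t →ₗ[Poly K n] I),
          IsBourbakiSeq t a b c I f g h ∧ ∀ i, g (Pi.single i 1) ≠ 0) ↔
      ∃ (β : Fin q → Koszul K n (t + 1)) (φ : Koszul K n (t + 1) →ₗ[Poly K n] Poly K n),
        IsBourbakiDatum t a b c β φ ∧ I = LinearMap.range φ := by
  constructor
  · rintro ⟨-, hI, f, g, h, H, hg⟩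
    exact H.exists_datum ht hI hg
  · rintro ⟨β, φ, H, rfl⟩
    exact ⟨H.isGradedIdeal, fun _ => H.range_ne_bot ht, H.exists_seq ht⟩

end Equivalence

/-! ### Removal of basis elements that are mapped to zero. -/

section Cancellation

variable {K : Type*} [Field K] {n : ℕ}

/-- The inclusion of free modules that omits the `j`-th basis element. -/
def insertZero (K : Type*) [Field K] (n : ℕ) {p : ℕ} (j : Fin (p + 1)) :
    (Fin p → Poly K n) →ₗ[Poly K n] (Fin (p + 1) → Poly K n) :=
  Function.ExtendByZero.linearMap (Poly K n) j.succAbove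

/-- The projection of free modules that forgets the `j`-th coordinate. -/
def forget (K : Type*) [Field K] (n : ℕ) {p : ℕ} (j : Fin (p + 1)) :
    (Fin (p + 1) → Poly K n) →ₗ[Poly K n] (Fin p → Poly K n) :=
  LinearMap.funLeft (Poly K n) (Poly K n) j.succAbove

variable {p : ℕ} (j : Fin (p + 1))

theorem insertZero_succAbove (v : Fin p → Poly K n) (k : Fin p) :
    insertZero K n j v (j.succAbove k) = v k :=
  Fin.succAbove_right_injective.extend_apply _ _ _

theorem insertZero_self (v : Fin p → Poly K n) : insertZero K n j v j = 0 :=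
  Function.extend_apply' _ _ _ fun ⟨k, hk⟩ => Fin.succAbove_ne j k hk

theorem forget_apply (v : Fin (p + 1) → Poly K n) (k : Fin p) :
    forget K n j v k = v (j.succAbove k) := rfl

theorem forget_insertZero (v : Fin p → Poly K n) : forget K n j (insertZero K n j v) = v := by
  ext1 k
  rw [forget_apply, insertZero_succAbove]

theorem insertZero_forget (v : Fin (p + 1) → Poly K n) :
    insertZero K n j (forget K n j v) = v - v j • Pi.single j 1 := by
  ext1 i
  rcases Fin.eq_self_or_eq_succAbove j i with rfl | ⟨k, rfl⟩
  · simp [insertZero_self]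
  · simp [insertZero_succAbove, forget_apply, Fin.succAbove_ne]

theorem isOfDegree_insertZero (a : Fin (p + 1) → ℤ) :
    IsOfDegree (freeDeg (K := K) (n := n) (a ∘ j.succAbove)) (freeDeg (K := K) a) 0
      (insertZero K n j) := by
  intro d v hv i
  rw [zero_add]
  rcases Fin.eq_self_or_eq_succAbove j i with rfl | ⟨k, rfl⟩
  · rw [insertZero_self]
    exact zero_mem _
  · rw [insertZero_succAbove]
    exact hv k

theorem isOfDegree_forget (a : Fin (p + 1) → ℤ) :
    IsOfDegree (freeDeg (K := K) (n := n) a) (freeDeg (K := K) (a ∘ j.succAbove)) 0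
      (forget K n j) := by
  intro d v hv k
  rw [zero_add]
  exact hv (j.succAbove k)

theorem isOfDegree_comp {M M' M'' : Type*} [AddCommGroup M] [Module K M] [Module (Poly K n) M]
    [AddCommGroup M'] [Module K M'] [Module (Poly K n) M']
    [AddCommGroup M''] [Module K M''] [Module (Poly K n) M'']
    {gr : ℤ → Submodule K M} {gr' : ℤ → Submodule K M'} {gr'' : ℤ → Submodule K M''}
    {g : M' →ₗ[Poly K n] M''} {f : M →ₗ[Poly K n] M'}
    (hg : IsOfDegree gr' gr'' 0 g) (hf : IsOfDegree gr gr' 0 f) :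
    IsOfDegree gr gr'' 0 (g ∘ₗ f) := by
  intro d x hx
  have h := hg _ _ (hf d x hx)
  rwa [zero_add] at h

/-- A basis element in the image of an injective homogeneous map is the image of a vector with
a unit coordinate. -/
theorem exists_unit_coordinate {p q : ℕ} {a : Fin p → ℤ} {b : Fin q → ℤ}
    {f : (Fin p → Poly K n) →ₗ[Poly K n] (Fin q → Poly K n)}
    (hf : IsOfDegree (freeDeg (K := K) a) (freeDeg (K := K) b) 0 f) {i : Fin q}
    (hi : Pi.single i 1 ∈ LinearMap.range f) :
    ∃ u, f u = Pi.single i 1 ∧ ∃ j, IsUnit (u j) := by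
  obtain ⟨u, hu, hfu⟩ := exists_homogeneous_preimage hf (single_one_mem_freeDeg b i) hi
  refine ⟨u, hfu, ?_⟩
  have h1 : f u i = 1 := by rw [hfu, Pi.single_eq_same]
  have h2 : f u i = ∑ j, u j * f (Pi.single j 1) i :=
    linearMap_apply_eq_sum (LinearMap.proj i ∘ₗ f) u
  -- The `i`-th coordinate reads `1 = ∑ u_j f_{ij}`, so some `u_j` has a nonzero constant term;
  -- being homogeneous, it is a constant.
  obtain ⟨j, hj⟩ : ∃ j, constantCoeff (u j) ≠ 0 := by
    by_contra! h
    have h3 := congrArg constantCoeff (h1.symm.trans h2)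
    simp [h] at h3
  refine ⟨j, ?_⟩
  rw [eq_C_of_mem_polyDeg (hu j) hj]
  exact (IsUnit.mk0 _ hj).map C

/-- If `e_i = f(u)` with `u_j` a unit, the quotients by `⟨u⟩` and `⟨e_i⟩` are free on the remaining
basis elements, and `f`, `g` induce maps on them that keep the sequence exact. -/
theorem IsBourbakiSeq.cancel {t p q : ℕ} {a : Fin p → ℤ} {b : Fin (q + 1) → ℤ} {c : ℤ}
    {I : Ideal (Poly K n)} {f : (Fin p → Poly K n) →ₗ[Poly K n] (Fin (q + 1) → Poly K n)}
    {g : (Fin (q + 1) → Poly K n) →ₗ[Poly K n] syz K n t} {h : syz K n t →ₗ[Poly K n] I}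
    (H : IsBourbakiSeq t a b c I f g h) {i : Fin (q + 1)} (hi : g (Pi.single i 1) = 0) :
    ∃ (p' : ℕ) (a' : Fin p' → ℤ) (f' : (Fin p' → Poly K n) →ₗ[Poly K n] (Fin q → Poly K n))
      (g' : (Fin q → Poly K n) →ₗ[Poly K n] syz K n t),
      IsBourbakiSeq t a' (b ∘ i.succAbove) c I f' g' h := by
  obtain ⟨u, hu, j, hj⟩ := exists_unit_coordinate H.degree_f ((H.exact_fg _).1 hi)
  obtain ⟨p, rfl⟩ : ∃ p', p = p' + 1 := ⟨p - 1, by have := j.2; omega⟩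
  obtain ⟨s, hs⟩ := hj.exists_right_inv
  have hg : ∀ v, g (insertZero K n i (forget K n i v)) = g v := by
    intro v
    rw [insertZero_forget, map_sub, map_smul, hi, smul_zero, sub_zero]
  refine ⟨p, a ∘ j.succAbove, forget K n i ∘ₗ f ∘ₗ insertZero K n j, g ∘ₗ insertZero K n i,
    ?_, ?_, H.degree_h, ?_, ?_, ?_, H.surjective⟩
  · exact isOfDegree_comp (isOfDegree_forget i b)
      (isOfDegree_comp H.degree_f (isOfDegree_insertZero j a))
  · exact isOfDegree_comp H.degree_g (isOfDegree_insertZero i b)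
  · refine (injective_iff_map_eq_zero _).2 fun x hx => ?_
    have h1 := insertZero_forget i (f (insertZero K n j x))
    have h2 : forget K n i (f (insertZero K n j x)) = 0 := hx
    rw [h2, map_zero, ← hu, ← map_smul, ← map_sub] at h1
    -- The extended vector equals `r • u`. Its `j`-th coordinate vanishes and `u_j` is a unit, so `r
    -- = 0`.
    have h3 := (injective_iff_map_eq_zero f).1 H.injective _ h1.symm
    set r := f (insertZero K n j x) i
    have h4 := congrFun h3 j
    rw [Pi.sub_apply, insertZero_self, Pi.smul_apply, smul_eq_mul, zero_sub, Pi.zero_apply,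
      neg_eq_zero] at h4
    have hr : r = 0 := by
      rcases mul_eq_zero.1 h4 with h5 | h5
      · exact h5
      · exact absurd h5 hj.ne_zero
    rw [hr, zero_smul, sub_zero] at h3
    rw [← forget_insertZero j x, h3, map_zero]
  · intro y
    constructor
    · intro hy
      obtain ⟨x, hx⟩ := (H.exact_fg (insertZero K n i y)).1 hy
      -- Since `s` is the inverse of `u_j`, this correction kills the `j`-th coordinate; it changes
      -- `f x` only by a multiple of `e_i`, which is then forgotten.
      refine ⟨forget K n j (x - (x j * s) • u), ?_⟩
      have h1 : insertZero K n j (forget K n j (x - (x j * s) • u)) = x - (x j * s) • u := by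
        rw [insertZero_forget, sub_eq_self]
        have : (x - (x j * s) • u) j = 0 := by
          rw [Pi.sub_apply, Pi.smul_apply, smul_eq_mul]
          linear_combination (-(x j)) * hs
        rw [this, zero_smul]
      rw [LinearMap.comp_apply, LinearMap.comp_apply, h1, map_sub, map_smul, hu, hx, map_sub,
        forget_insertZero, sub_eq_self]
      ext1 k
      simp [forget_apply, Fin.succAbove_ne]
    · rintro ⟨x, rfl⟩
      rw [LinearMap.comp_apply, LinearMap.comp_apply, LinearMap.comp_apply, hg,
        H.exact_fg.apply_apply_eq_zero]
  · intro x
    rw [H.exact_gh]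
    constructor
    · rintro ⟨v, rfl⟩
      exact ⟨forget K n i v, hg v⟩
    · rintro ⟨v, rfl⟩
      exact ⟨insertZero K n i v, rfl⟩

theorem IsBourbakiSeq.exists_reduced {t p q : ℕ} {a : Fin p → ℤ} {b : Fin q → ℤ} {c : ℤ}
    {I : Ideal (Poly K n)} {f : (Fin p → Poly K n) →ₗ[Poly K n] (Fin q → Poly K n)}
    {g : (Fin q → Poly K n) →ₗ[Poly K n] syz K n t} {h : syz K n t →ₗ[Poly K n] I}
    (H : IsBourbakiSeq t a b c I f g h) :
    ∃ (p' q' : ℕ) (a' : Fin p' → ℤ) (b' : Fin q' → ℤ)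
      (f' : (Fin p' → Poly K n) →ₗ[Poly K n] (Fin q' → Poly K n))
      (g' : (Fin q' → Poly K n) →ₗ[Poly K n] syz K n t),
      IsBourbakiSeq t a' b' c I f' g' h ∧ ∀ i, g' (Pi.single i 1) ≠ 0 := by
  induction q generalizing p with
  | zero => exact ⟨p, 0, a, b, f, g, H, fun i => i.elim0⟩
  | succ q ih =>
    by_cases hg : ∀ i, g (Pi.single i 1) ≠ 0
    · exact ⟨p, q + 1, a, b, f, g, H, hg⟩
    · push Not at hg
      obtain ⟨i, hi⟩ := hg
      obtain ⟨p', a', f', g', H'⟩ := H.cancel hi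
      exact ih H'

end Cancellation

end LongBourbaki

end

theorem theorem2p3 {K : Type*} [Field K] (n t : ℕ) (ht : t + 2 ≤ n) (c : ℤ)
    (I : Ideal (LongBourbaki.Poly K n)) :
    -- the equivalence for given ranks and twists
    (∀ (p q : ℕ) (a : Fin p → ℤ) (b : Fin q → ℤ),
      (LongBourbaki.IsGradedIdeal I ∧ (n = t + 2 → I ≠ ⊥) ∧
        ∃ (f : (Fin p → LongBourbaki.Poly K n) →ₗ[LongBourbaki.Poly K n]
              (Fin q → LongBourbaki.Poly K n))
          (g : (Fin q → LongBourbaki.Poly K n) →ₗ[LongBourbaki.Poly K n]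
              LongBourbaki.syz K n t)
          (h : LongBourbaki.syz K n t →ₗ[LongBourbaki.Poly K n] I),
          LongBourbaki.IsBourbakiSeq t a b c I f g h ∧ ∀ i, g (Pi.single i 1) ≠ 0)
      ↔
      ∃ (β : Fin q → LongBourbaki.Koszul K n (t + 1))
        (φ : LongBourbaki.Koszul K n (t + 1) →ₗ[LongBourbaki.Poly K n] LongBourbaki.Poly K n),
        LongBourbaki.IsBourbakiDatum t a b c β φ ∧ I = LinearMap.range φ) ∧
    -- the equivalence for arbitrary sequences, when ranks and twists may change
    ((LongBourbaki.IsGradedIdeal I ∧ (n = t + 2 → I ≠ ⊥) ∧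
        ∃ (p q : ℕ) (a : Fin p → ℤ) (b : Fin q → ℤ)
          (f : (Fin p → LongBourbaki.Poly K n) →ₗ[LongBourbaki.Poly K n]
              (Fin q → LongBourbaki.Poly K n))
          (g : (Fin q → LongBourbaki.Poly K n) →ₗ[LongBourbaki.Poly K n]
              LongBourbaki.syz K n t)
          (h : LongBourbaki.syz K n t →ₗ[LongBourbaki.Poly K n] I),
          LongBourbaki.IsBourbakiSeq t a b c I f g h)
      ↔
      ∃ (p q : ℕ) (a : Fin p → ℤ) (b : Fin q → ℤ)
        (β : Fin q → LongBourbaki.Koszul K n (t + 1))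
        (φ : LongBourbaki.Koszul K n (t + 1) →ₗ[LongBourbaki.Poly K n] LongBourbaki.Poly K n),
        LongBourbaki.IsBourbakiDatum t a b c β φ ∧ I = LinearMap.range φ) := by
  refine ⟨fun p q a b => LongBourbaki.bourbakiSeq_iff_datum ht I, ?_⟩
  constructor
  · rintro ⟨hI, hne, p, q, a, b, f, g, h, H⟩
    -- Cancellation changes the ranks and twists but neither `I` nor `h`, so the first equivalence
    -- applies to the reduced sequence.
    obtain ⟨p', q', a', b', f', g', H', hg'⟩ := H.exists_reduced
    exact ⟨p', q', a', b', (LongBourbaki.bourbakiSeq_iff_datum ht I).1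
      ⟨hI, hne, f', g', h, H', hg'⟩⟩
  · rintro ⟨p, q, a, b, hd⟩
    obtain ⟨hI, hne, f, g, h, H, -⟩ := (LongBourbaki.bourbakiSeq_iff_datum ht I).2 hd
    exact ⟨hI, hne, p, q, a, b, f, g, h, H⟩
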